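/- **Setting.** Let $k$ be a nonzero commutative ring. Let $\mathcal C$ be the category whose objects are the finite sets and in which a morphism from $X$ to $Y$ is a correspondence, that is, a subset of $Y\times X$. The composite of $R\subseteq Z\times Y$ and $S\subseteq Y\times X$ is $RS=\{(z,x)\mid \exists y\in Y,\ (z,y)\in R,\ (y,x)\in S\}$. Write $\mathcal C(Y,X)$ for the set of correspondences from $X$ to $Y$, and let $k\mathcal C$ be the $k$-linearization of $\mathcal C$. A correspondence functor is a $k$-linear functor from $k\mathcal C$ to $k$-modules. Morphisms of correspondence functors are natural transformations, and subfunctors, quotients, kernels and surjectivity are understood pointwise. An order on a finite set is a partial order relation, where $(a,b)\in R$ means $a\le_R b$, and $R^{op}$ is the opposite order. *Fundamental functors.* Let $(E,R)$ be a finite poset. A relation on $E$ is inessential if it factors through a set with fewer than $|E|$ elements. Let $\mathcal P_E$ be the quotient of the algebra $k\mathcal C(E,E)$ by the two-sided ideal generated by all inessential relations and all differences $S-\overline S$, where $S$ is a reflexive relation on $E$ and $\overline S$ is its transitive closure. Let $f_R=\sum_{S\supseteq R}\mu(R,S)\,S\in\mathcal P_E$, where $S$ runs over the orders on $E$ containing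 $R$ and $\mu$ is the Möbius function of the set of orders on $E$, ordered by inclusion. The fundamental module $\mathcal P_Ef_R$ is the left ideal generated by $f_R$, seen as a $k\mathcal C(E,E)$-module $W$. Set $L_{E,W}(X)=k\mathcal C(X,E)\otimes_{k\mathcal C(E,E)}W$, and let $J_{E,W}(X)$ be the set of all $\sum_i\phi_i\otimes w_i\in L_{E,W}(X)$ such that $\sum_i(\psi\phi_i)\cdot w_i=0$ for all $\psi\in k\mathcal C(E,X)$. The fundamental functor of $(E,R)$ is $\mathbb S_{E,R}=L_{E,W}/J_{E,W}$ for $W=\mathcal P_Ef_R$. *Functors of lattices.* Let $T$ be a finite lattice with least element $\hat 0$. Let $F_T(X)$ be the free $k$-module on the set of all maps $X\to T$, on which a correspondence $S\subseteq Y\times X$ acts by $(S\varphi)(y)=\bigvee_{(y,x)\in S}\varphi(x)$, an empty join being $\hat 0$. Let $E$ be the set of (join-)irreducible elements of $T$ ($\hat 0$ is not irreducible), let $R$ be the restriction to $E$ of the order of $T$, and let $\iota:E\to T$ be the inclusion. Let $H_T$ be the subfunctor of $F_T$ such that $H_T(X)$ is spanned by all maps $\varphi:X\to T$ with $E\not\subseteq\varphi(X)$.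 **Theorem.** Let $T$ be a finite lattice and let $(E,R)$ be the full subposet of its irreducible elements. Let $(D,Q)$ be a finite poset such that there exists a surjective morphism of correspondence functors $\Phi:F_T/H_T\to\mathbb S_{D,Q}$. Then: 1. $|D|=|E|$. 2. The posets $(D,Q)$ and $(E,R^{op})$ are isomorphic. In particular, if $D=E$, there is a permutation $\sigma$ of $E$ such that $R^{op}=\{(\sigma(a),\sigma(b))\mid(a,b)\in Q\}$. 3. There is a unique morphism $\Theta_T:F_T\to\mathbb S_{E,R^{op}}$ sending $\iota\in F_T(E)$ to the class of $\Delta_E\otimes f_{R^{op}}$, where $\Delta_E$ is the identity relation on $E$. It induces a morphism $\overline\Theta_T:F_T/H_T\to\mathbb S_{E,R^{op}}$. The kernel of $\overline\Theta_T$ vanishes at $E$, and $$\overline\Theta_{T,E}:F_T(E)/H_T(E)\longrightarrow\mathbb S_{E,R^{op}}(E)$$ is an isomorphism. Moreover, $w\mapsto\Delta_E\otimes w$ induces an isomorphism $\mathcal P_Ef_{R^{op}}\cong\mathbb S_{E,R^{op}}(E)$ of $k\mathcal C(E,E)$-modules. -/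

import Mathlib

open CategoryTheory TensorProduct

universe u v w

/-! ### Finite sets and correspondences -/

/-- Finite sets, the objects of the category of correspondences. -/
structure FinCorr : Type (u + 1) where
  carrier : Type u
  [isFinite : Finite carrier]

namespace FinCorr

instance : CoeSort FinCorr.{u} (Type u) := ⟨carrier⟩

instance (X : FinCorr.{u}) : Finite X := X.isFinite

/-- A correspondence from `X` to `Y` is a subset of `Y × X`. -/
@[ext]
structure Hom (X Y : FinCorr.{u}) : Type u where
  rel : Set (Y × X)

/-- The composite of `S ⊆ Y × X` and `R ⊆ Z × Y`, in diagrammatic order `S ≫ R`, is the set of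
all `(z, x)` such that `(z, y) ∈ R` and `(y, x) ∈ S` for some `y`. -/
instance : Category FinCorr.{u} where
  Hom := Hom
  id X := ⟨{p | p.1 = p.2}⟩
  comp {X Y Z} S R := ⟨{p : Z × X | ∃ y : Y, (p.1, y) ∈ R.rel ∧ (y, p.2) ∈ S.rel}⟩
  id_comp S := by ext ⟨a, b⟩; simp
  comp_id S := by ext ⟨a, b⟩; simp
  assoc S R Q := by
    ext ⟨a, b⟩
    constructor
    · rintro ⟨y, h, z, h', h''⟩
      exact ⟨z, ⟨y, h, h'⟩, h''⟩
    · rintro ⟨z, ⟨y, h, h'⟩, h''⟩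
      exact ⟨y, h, z, h', h''⟩

end FinCorr

/-- An order on `X`: a partial order relation, seen as a subset of `X × X`, where `(a, b)` belongs
to the relation if and only if `a ≤ b`. -/
@[ext]
structure OrderOn (X : Type u) : Type u where
  rel : Set (X × X)
  refl : ∀ a, (a, a) ∈ rel
  antisymm : ∀ a b, (a, b) ∈ rel → (b, a) ∈ rel → a = b
  trans : ∀ a b c, (a, b) ∈ rel → (b, c) ∈ rel → (a, c) ∈ rel

namespace OrderOn

/-- The orders on `X` are ordered by inclusion of relations. -/
instance (X : Type u) : PartialOrder (OrderOn X) :=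
  PartialOrder.lift OrderOn.rel fun _ _ h => OrderOn.ext h

instance (X : Type u) [Finite X] : Finite (OrderOn X) :=
  Finite.of_injective OrderOn.rel fun _ _ h => OrderOn.ext h

noncomputable instance (X : Type u) [Finite X] : Fintype (OrderOn X) := Fintype.ofFinite _

open Classical in
noncomputable instance (X : Type u) [Finite X] : LocallyFiniteOrder (OrderOn X) :=
  Fintype.toLocallyFiniteOrder

/-- The opposite order. -/
def op {X : Type u} (R : OrderOn X) : OrderOn X where
  rel := {p | (p.2, p.1) ∈ R.rel}
  refl a := R.refl a
  antisymm a b h h' := R.antisymm a b h' h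
  trans a b c h h' := R.trans c b a h' h

/-- The order relation of a partially ordered type. -/
def ofLE (X : Type u) [PartialOrder X] : OrderOn X where
  rel := {p | p.1 ≤ p.2}
  refl a := le_refl a
  antisymm _ _ h h' := le_antisymm h h'
  trans _ _ _ h h' := le_trans h h'

end OrderOn

namespace FinCorr

/-- An order on a finite set, as a relation on that set. -/
def ofOrder {X : FinCorr.{u}} (R : OrderOn X) : X ⟶ X := ⟨R.rel⟩

/-- A relation on `X` is inessential if it factors through a set of cardinality strictly smaller
than that of `X`. -/
def Inessential {X : FinCorr.{u}} (S : X ⟶ X) : Prop :=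
  ∃ (Y : FinCorr.{u}) (V : X ⟶ Y) (U : Y ⟶ X), Nat.card Y < Nat.card X ∧ S = V ≫ U

/-- Reflexive relations. -/
def Reflexive {X : FinCorr.{u}} (S : X ⟶ X) : Prop := ∀ a : X, (a, a) ∈ S.rel

/-- The transitive closure of a relation. -/
def transClosure {X : FinCorr.{u}} (S : X ⟶ X) : X ⟶ X :=
  ⟨{p | Relation.TransGen (fun a b => (a, b) ∈ S.rel) p.1 p.2}⟩

end FinCorr

noncomputable section

/-! ### Correspondence functors -/

/-- The `k`-linearization of the category of finite sets and correspondences. -/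
abbrev LinCorr (k : Type v) [CommRing k] := Free k FinCorr.{u}

/-- A correspondence, as a basis element of the module of morphisms of the linearization. -/
def lin (k : Type v) [CommRing k] {X Y : FinCorr.{u}} (S : X ⟶ Y) :
    Free.of k X ⟶ Free.of k Y :=
  (Free.embedding k FinCorr.{u}).map S

lemma lin_id (k : Type v) [CommRing k] (X : FinCorr.{u}) : lin k (𝟙 X) = 𝟙 (Free.of k X) :=
  (Free.embedding k FinCorr.{u}).map_id X

lemma lin_comp (k : Type v) [CommRing k] {X Y Z : FinCorr.{u}} (S : X ⟶ Y) (R : Y ⟶ Z) :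
    lin k (S ≫ R) = lin k S ≫ lin k R :=
  (Free.embedding k FinCorr.{u}).map_comp S R

/-- The morphisms from `X` to `Y` of `LinCorr k` form the free `k`-module on the set of all
correspondences from `X` to `Y`. -/
def linEquiv (k : Type v) [CommRing k] (X Y : FinCorr.{u}) :
    (Free.of k X ⟶ Free.of k Y) ≃ₗ[k] ((X ⟶ Y) →₀ k) where
  toFun α := α
  invFun α := α
  map_add' _ _ := rfl
  map_smul' _ _ := rfl
  left_inv _ := rfl
  right_inv _ := rfl

lemma linEquiv_lin (k : Type v) [CommRing k] {X Y : FinCorr.{u}} (S : X ⟶ Y) :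
    linEquiv k X Y (lin k S) = Finsupp.single S 1 := rfl

lemma lin_hom_ext {k : Type v} [CommRing k] {X Y : FinCorr.{u}} {W : Type w} [AddCommMonoid W]
    [Module k W] {f g : (Free.of k X ⟶ Free.of k Y) →ₗ[k] W}
    (h : ∀ S : X ⟶ Y, f (lin k S) = g (lin k S)) : f = g := by
  have H : f ∘ₗ (linEquiv k X Y).symm.toLinearMap = g ∘ₗ (linEquiv k X Y).symm.toLinearMap :=
    Finsupp.lhom_ext' fun S => LinearMap.ext_ring (h S)
  ext α
  exact LinearMap.congr_fun H (linEquiv k X Y α)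

/-- The category of functors from `LinCorr k` to `k`-modules. A correspondence functor over `k` is
a `k`-linear such functor; for each functor constructed below, `k`-linearity is proved as instances
of `Functor.Additive` and `Functor.Linear k`. -/
abbrev CorrFunctor (k : Type v) [CommRing k] := LinCorr.{u} k ⥤ ModuleCat.{max u v} k

/-- A subfunctor of a correspondence functor. -/
structure SubCorrFunctor {k : Type v} [CommRing k] (M : CorrFunctor.{u} k) where
  obj : ∀ X : LinCorr.{u} k, Submodule k (M.obj X)
  map_le : ∀ {X Y : LinCorr.{u} k} (α : X ⟶ Y), obj X ≤ (obj Y).comap (M.map α).hom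

namespace SubCorrFunctor

variable {k : Type v} [CommRing k] {M : CorrFunctor.{u} k}

/-- The quotient of a correspondence functor by a subfunctor. -/
def quotient (N : SubCorrFunctor M) : CorrFunctor.{u} k where
  obj X := ModuleCat.of k (M.obj X ⧸ N.obj X)
  map {X Y} α := ModuleCat.ofHom ((N.obj X).mapQ (N.obj Y) (M.map α).hom (N.map_le α))
  map_id X := by
    ext x
    simp
  map_comp α β := by
    ext x
    simp

instance (N : SubCorrFunctor M) [M.Additive] : N.quotient.Additive where
  map_add := by
    intro X Y α β
    ext x
    obtain ⟨x, rfl⟩ := (N.obj X).mkQ_surjective x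
    change (N.obj Y).mkQ ((M.map (α + β)).hom x) =
      (N.obj Y).mkQ ((M.map α).hom x) + (N.obj Y).mkQ ((M.map β).hom x)
    rw [M.map_add, ModuleCat.hom_add, LinearMap.add_apply, map_add]

instance (N : SubCorrFunctor M) [M.Linear k] : N.quotient.Linear k where
  map_smul := by
    intro X Y α r
    ext x
    obtain ⟨x, rfl⟩ := (N.obj X).mkQ_surjective x
    change (N.obj Y).mkQ ((M.map (r • α)).hom x) = r • (N.obj Y).mkQ ((M.map α).hom x)
    rw [M.map_smul, ModuleCat.hom_smul, LinearMap.smul_apply, map_smul]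

/-- The projection of a correspondence functor onto a quotient. -/
def proj (N : SubCorrFunctor M) : M ⟶ N.quotient where
  app X := ModuleCat.ofHom (N.obj X).mkQ
  naturality X Y α := by
    rfl

/-- The kernel of a morphism of correspondence functors. -/
def ker {M' : CorrFunctor.{u} k} (f : M ⟶ M') : SubCorrFunctor M where
  obj X := LinearMap.ker (f.app X).hom
  map_le {X Y} α := by
    intro x hx
    have h := congrArg (fun g => ModuleCat.Hom.hom g x) (f.naturality α)
    simp only [ModuleCat.hom_comp, LinearMap.comp_apply] at h
    rw [LinearMap.mem_ker] at hx
    rw [Submodule.mem_comap, LinearMap.mem_ker, h, hx, map_zero]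

end SubCorrFunctor

/-! ### The functor of a finite lattice -/

section Lattice

variable (k : Type v) [CommRing k] (T : Type u) [Lattice T] [BoundedOrder T]

variable {T} in
/-- The action of a correspondence `S ⊆ Y × X` on a map `φ : X → T`: the value at `y` is the join of
all `φ x` with `(y, x) ∈ S`. -/
def corrAct {X Y : FinCorr.{u}} (S : X ⟶ Y) (φ : X → T) : Y → T :=
  fun y => (Set.toFinite {x : X | (y, x) ∈ S.rel}).toFinset.sup φ

variable {T} in
lemma corrAct_id {X : FinCorr.{u}} (φ : X → T) : corrAct (𝟙 X) φ = φ := by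
  funext y
  apply le_antisymm
  · refine Finset.sup_le fun x hx => ?_
    rw [Set.Finite.mem_toFinset] at hx
    rw [show y = x from hx]
  · refine Finset.le_sup (f := φ) ?_
    rw [Set.Finite.mem_toFinset]
    exact rfl

variable {T} in
lemma corrAct_comp {X Y Z : FinCorr.{u}} (S : X ⟶ Y) (R : Y ⟶ Z) (φ : X → T) :
    corrAct (S ≫ R) φ = corrAct R (corrAct S φ) := by
  funext z
  apply le_antisymm
  · refine Finset.sup_le fun x hx => ?_
    rw [Set.Finite.mem_toFinset] at hx
    obtain ⟨y, hy, hx⟩ := hx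
    refine le_trans (Finset.le_sup (f := φ) (b := x) ?_)
      (Finset.le_sup (f := corrAct S φ) (b := y) ?_)
    · rw [Set.Finite.mem_toFinset]
      exact hx
    · rw [Set.Finite.mem_toFinset]
      exact hy
  · refine Finset.sup_le fun y hy => Finset.sup_le fun x hx => ?_
    rw [Set.Finite.mem_toFinset] at hx hy
    refine Finset.le_sup (f := φ) ?_
    rw [Set.Finite.mem_toFinset]
    exact ⟨y, hy, hx⟩

/-- The action of `k`-linear combinations of correspondences on `k (T ^ X)`. -/
def latticeMap (X Y : FinCorr.{u}) :
    (Free.of k X ⟶ Free.of k Y) →ₗ[k] ((X → T) →₀ k) →ₗ[k] ((Y → T) →₀ k) :=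
  Finsupp.lift _ k (X ⟶ Y) (fun S => Finsupp.lmapDomain k k (corrAct S)) ∘ₗ
    (linEquiv k X Y).toLinearMap

lemma latticeMap_lin {X Y : FinCorr.{u}} (S : X ⟶ Y) :
    latticeMap k T X Y (lin k S) = Finsupp.lmapDomain k k (corrAct S) := by
  rw [latticeMap, LinearMap.comp_apply, LinearEquiv.coe_coe, linEquiv_lin]
  simp

lemma latticeMap_comp {X Y Z : FinCorr.{u}} (α : Free.of k X ⟶ Free.of k Y)
    (β : Free.of k Y ⟶ Free.of k Z) :
    latticeMap k T X Z (α ≫ β) = latticeMap k T Y Z β ∘ₗ latticeMap k T X Y α := by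
  have H : (Linear.comp (S := k) (Free.of k X) (Free.of k Y) (Free.of k Z)).compr₂ (latticeMap k T X Z) =
      ((LinearMap.llcomp k ((X → T) →₀ k) ((Y → T) →₀ k) ((Z → T) →₀ k) ∘ₗ
        latticeMap k T Y Z).flip ∘ₗ latticeMap k T X Y) := by
    refine lin_hom_ext (k := k) (X := X) (Y := Y)
      (W := (Free.of k Y ⟶ Free.of k Z) →ₗ[k] ((X → T) →₀ k) →ₗ[k] ((Z → T) →₀ k)) fun S => ?_
    refine lin_hom_ext (k := k) (X := Y) (Y := Z) (W := ((X → T) →₀ k) →ₗ[k] ((Z → T) →₀ k))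
      fun R => ?_
    change latticeMap k T X Z (lin k S ≫ lin k R) =
      latticeMap k T Y Z (lin k R) ∘ₗ latticeMap k T X Y (lin k S)
    rw [← lin_comp, latticeMap_lin, latticeMap_lin, latticeMap_lin]
    ext φ : 2
    simp [corrAct_comp]
  exact LinearMap.congr_fun (LinearMap.congr_fun H α) β

/-- The correspondence functor `F_T` of the finite lattice `T`: its value at `X` is the free
`k`-module on the set of all maps `X → T`. -/
def latticeFunctor : CorrFunctor.{u} k where
  obj X := ModuleCat.of k ((X.carrier → T) →₀ k)
  map {X Y} α := ModuleCat.ofHom (latticeMap k T X Y α)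
  map_id X := by
    have h (X : FinCorr.{u}) : latticeMap k T X X (𝟙 (Free.of k X)) = LinearMap.id := by
      rw [← lin_id, latticeMap_lin]
      ext φ : 2
      simp [corrAct_id]
    exact congrArg ModuleCat.ofHom (h X)
  map_comp {X Y Z} α β := congrArg ModuleCat.ofHom (latticeMap_comp k T α β)

instance : (latticeFunctor k T).Additive where
  map_add {X Y α β} := congrArg ModuleCat.ofHom (map_add (latticeMap k T X Y) α β)

instance : (latticeFunctor k T).Linear k where
  map_smul {X Y} α r := congrArg ModuleCat.ofHom (map_smul (latticeMap k T X Y) r α)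

/-- The finite set of (join-)irreducible elements of the finite lattice `T`. -/
def irr [Finite T] : FinCorr.{u} := ⟨{e : T // SupIrred e}⟩

/-- The order of `T`, restricted to the set of irreducible elements. -/
def irrOrder [Finite T] : OrderOn (irr T) := OrderOn.ofLE {e : T // SupIrred e}

/-- The inclusion map of the set of irreducible elements in `T`, as an element of the value of
`latticeFunctor k T` at this set. -/
def irrIncl [Finite T] : (latticeFunctor k T).obj (Free.of k (irr T)) :=
  Finsupp.single (fun e : {e : T // SupIrred e} => (e : T)) (1 : k)

/-- The submodule of `k (T ^ X)` generated by all maps `φ : X → T` whose image does not contain all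
irreducible elements of `T`. -/
def nonFullSubmodule (X : FinCorr.{u}) : Submodule k ((X → T) →₀ k) :=
  Submodule.span k
    {m | ∃ φ : X → T, ¬ {e : T | SupIrred e} ⊆ Set.range φ ∧ m = Finsupp.single φ 1}

lemma nonFullSubmodule_le {X Y : FinCorr.{u}} (α : Free.of k X ⟶ Free.of k Y) :
    nonFullSubmodule k T X ≤ (nonFullSubmodule k T Y).comap (latticeMap k T X Y α) := by
  refine Submodule.span_le.2 ?_
  rintro _ ⟨φ, hφ, rfl⟩
  have H : (nonFullSubmodule k T Y).mkQ ∘ₗ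
      (latticeMap k T X Y).flip (Finsupp.single φ 1) = 0 := by
    refine lin_hom_ext fun S => ?_
    rw [LinearMap.comp_apply, LinearMap.flip_apply, latticeMap_lin, LinearMap.zero_apply,
      Submodule.mkQ_apply, Submodule.Quotient.mk_eq_zero, Finsupp.lmapDomain_apply,
      Finsupp.mapDomain_single]
    refine Submodule.subset_span ⟨_, fun h => hφ fun e he => ?_, rfl⟩
    obtain ⟨y, hy⟩ := h he
    obtain ⟨x, -, hx⟩ := SupIrred.finset_sup_eq he hy
    exact ⟨x, hx⟩
  have h := LinearMap.congr_fun H α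
  rwa [LinearMap.comp_apply, LinearMap.zero_apply, Submodule.mkQ_apply,
    Submodule.Quotient.mk_eq_zero] at h

/-- The subfunctor `H_T` of `F_T`. -/
def nonFull : SubCorrFunctor (latticeFunctor k T) where
  obj X := nonFullSubmodule k T X
  map_le α := nonFullSubmodule_le k T α

end Lattice

/-! ### The functors `L_{E,W}` and `J_{E,W}` -/

section Induction

variable {k : Type v} [CommRing k] (E : LinCorr.{u} k) (W : Type (max u v)) [AddCommGroup W]
  [Module k W]

/-- Left multiplication by `α` on the tensor product over `k`, before passing to the quotient. -/
def balancedMap (X Y : LinCorr.{u} k) :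
    (X ⟶ Y) →ₗ[k]
      ((E ⟶ X) ⊗[k] W) →ₗ[k] ((E ⟶ Y) ⊗[k] W) :=
  LinearMap.rTensorHom W ∘ₗ (Linear.comp E (X) (Y)).flip

lemma balancedMap_tmul {X Y : LinCorr.{u} k} (α : X ⟶ Y)
    (φ : E ⟶ X) (w : W) :
    balancedMap E W X Y α (φ ⊗ₜ[k] w) = (φ ≫ α) ⊗ₜ[k] w := rfl

variable [Module (End E) W]

/-- The relations defining the tensor product, over the (noncommutative) algebra of relations on
`E`, of the module of morphisms from `E` to `X` with `W`, as a quotient of the tensor product over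
`k`. The composite `a ≫ φ` is the product `φ a` in the notation for left actions. -/
def balancing (X : LinCorr.{u} k) : Submodule k ((E ⟶ X) ⊗[k] W) :=
  Submodule.span k {t | ∃ (φ : E ⟶ X) (a : End E) (w : W),
    t = ((a ≫ φ : E ⟶ X) ⊗ₜ[k] w) - φ ⊗ₜ[k] (a • w)}

lemma balancing_le {X Y : LinCorr.{u} k} (α : X ⟶ Y) :
    balancing E W X ≤ (balancing E W Y).comap (balancedMap E W X Y α) := by
  refine Submodule.span_le.2 ?_
  rintro _ ⟨φ, a, w, rfl⟩
  refine Submodule.subset_span ⟨φ ≫ α, a, w, ?_⟩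
  rw [map_sub, balancedMap_tmul, balancedMap_tmul, Category.assoc]

/-- The functor `X ↦ k𝒞(X, E) ⊗ W`, the tensor product being over `k𝒞(E, E)`. -/
def indFunctor : CorrFunctor.{u} k where
  obj X := ModuleCat.of k (((E ⟶ X) ⊗[k] W) ⧸ balancing E W X)
  map {X Y} α := ModuleCat.ofHom
    ((balancing E W X).mapQ (balancing E W Y) (balancedMap E W X Y α)
      (balancing_le E W α))
  map_id X := by
    refine ModuleCat.hom_ext (Submodule.linearMap_qext _ (TensorProduct.ext' fun φ w => ?_))
    change (balancing E W X).mkQ ((φ ≫ 𝟙 X) ⊗ₜ[k] w) =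
      (balancing E W X).mkQ (φ ⊗ₜ[k] w)
    rw [Category.comp_id]
  map_comp {X Y Z} α β := by
    refine ModuleCat.hom_ext (Submodule.linearMap_qext _ (TensorProduct.ext' fun φ w => ?_))
    change (balancing E W Z).mkQ ((φ ≫ α ≫ β) ⊗ₜ[k] w) =
      (balancing E W Z).mkQ (((φ ≫ α) ≫ β) ⊗ₜ[k] w)
    rw [Category.assoc]

instance : (indFunctor E W).Additive where
  map_add {X Y α β} := by
    refine ModuleCat.hom_ext (Submodule.linearMap_qext _ (TensorProduct.ext' fun φ w => ?_))
    change (balancing E W Y).mkQ ((φ ≫ (α + β)) ⊗ₜ[k] w) =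
      (balancing E W Y).mkQ ((φ ≫ α) ⊗ₜ[k] w) +
        (balancing E W Y).mkQ ((φ ≫ β) ⊗ₜ[k] w)
    rw [Preadditive.comp_add, TensorProduct.add_tmul, map_add]

instance : (indFunctor E W).Linear k where
  map_smul {X Y} α r := by
    refine ModuleCat.hom_ext (Submodule.linearMap_qext _ (TensorProduct.ext' fun φ w => ?_))
    change (balancing E W Y).mkQ ((φ ≫ (r • α)) ⊗ₜ[k] w) =
      r • (balancing E W Y).mkQ ((φ ≫ α) ⊗ₜ[k] w)
    rw [Linear.comp_smul, ← map_smul, TensorProduct.smul_tmul']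

/-- The bilinear map sending `(φ, w)` to the class of the tensor `φ ⊗ w`. -/
def indMk (X : LinCorr.{u} k) :
    (E ⟶ X) →ₗ[k] W →ₗ[k] (indFunctor E W).obj X :=
  (TensorProduct.mk k (E ⟶ X) W).compr₂ (balancing E W X).mkQ

variable [IsScalarTower k (End E) W]

/-- The map sending `φ ⊗ w` to `(ψ φ) • w`, where `ψ φ` is the composite `φ ≫ ψ`. -/
def indEval (X : LinCorr.{u} k) (ψ : X ⟶ E) :
    (indFunctor E W).obj X →ₗ[k] W :=
  (balancing E W X).liftQ
    (TensorProduct.lift ((Algebra.lsmul k k W : (End E) →ₐ[k] _).toLinearMap ∘ₗ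
      Linear.rightComp k E ψ)) <| by
    refine Submodule.span_le.2 ?_
    rintro _ ⟨φ, a, w, rfl⟩
    rw [SetLike.mem_coe, LinearMap.mem_ker, map_sub, sub_eq_zero]
    change End.of ((a ≫ φ) ≫ ψ) • w = End.of (φ ≫ ψ) • a • w
    rw [smul_smul, End.mul_def, Category.assoc]

lemma indEval_indMk {X : LinCorr.{u} k} (ψ : X ⟶ E)
    (φ : E ⟶ X) (w : W) :
    indEval E W X ψ (indMk E W X φ w) = End.of (φ ≫ ψ) • w := rfl

lemma indEval_map {X Y : LinCorr.{u} k} (α : X ⟶ Y)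
    (ψ : Y ⟶ E) :
    indEval E W Y ψ ∘ₗ ((indFunctor E W).map α).hom = indEval E W X (α ≫ ψ) := by
  refine Submodule.linearMap_qext _ (TensorProduct.ext' fun φ w => ?_)
  change End.of ((φ ≫ α) ≫ ψ) • w = End.of (φ ≫ α ≫ ψ) • w
  rw [Category.assoc]

/-- The subfunctor `J` of `indFunctor E W`: it consists at `X` of all elements `∑ φᵢ ⊗ wᵢ` such that
`∑ (ψ φᵢ) • wᵢ = 0` for all `ψ` from `X` to `E`. -/
def indRadical : SubCorrFunctor (indFunctor E W) where
  obj X := ⨅ ψ : X ⟶ E, LinearMap.ker (indEval E W X ψ)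
  map_le {X Y} α := by
    intro x hx
    rw [Submodule.mem_comap, Submodule.mem_iInf]
    intro ψ
    have h := LinearMap.congr_fun (indEval_map E W α ψ) x
    rw [LinearMap.comp_apply] at h
    rw [LinearMap.mem_ker, h]
    exact (Submodule.mem_iInf _).1 hx (α ≫ ψ)

end Induction

/-! ### Fundamental modules and fundamental functors -/

section Fundamental

variable (k : Type v) [CommRing k] {E : FinCorr.{u}}

variable (E) in
/-- The defining relations of the algebra of permuted orders on `E`, as a quotient of the algebra
of relations on `E`: inessential relations are zero and every reflexive relation is equal to its
transitive closure. -/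
inductive PermutedOrderRel : End (Free.of k E) → End (Free.of k E) → Prop
  | inessential (S : E ⟶ E) : FinCorr.Inessential S → PermutedOrderRel (lin k S) 0
  | reflexive (S : E ⟶ E) : FinCorr.Reflexive S →
      PermutedOrderRel (lin k S) (lin k (FinCorr.transClosure S))

variable (E) in
/-- The algebra of permuted orders on `E`. Its `k`-basis consists of the classes of the relations
`Δ_σ R`, where `σ` is a permutation of `E` and `R` is an order on `E`. The product of two orders
`R` and `S` is the transitive closure of `R ∪ S` if this is an order, and zero otherwise. -/
abbrev PermutedOrders := RingQuot (PermutedOrderRel k E)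

variable (E) in
/-- The projection of the algebra of relations on `E` onto the algebra of permuted orders. -/
def toPermutedOrders : End (Free.of k E) →ₐ[k] PermutedOrders k E :=
  RingQuot.mkAlgHom k (PermutedOrderRel k E)

open Classical in
/-- The idempotent `f_R` of the algebra of permuted orders: the sum over all orders `S` containing
`R` of `μ(R, S) S`, where `μ` is the Möbius function of the set of orders on `E`, ordered by
inclusion. -/
def fundIdempotent (R : OrderOn E) : PermutedOrders k E :=
  ∑ S : OrderOn E with R ≤ S,
    IncidenceAlgebra.mu k R S • toPermutedOrders k E (lin k (FinCorr.ofOrder S))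

/-- The fundamental module: the left ideal generated by `f_R` in the algebra of permuted orders. -/
def FundModule (R : OrderOn E) : Type (max u v) :=
  ↥(Ideal.span {fundIdempotent k R} : Ideal (PermutedOrders k E))

instance (R : OrderOn E) : AddCommGroup (FundModule k R) :=
  inferInstanceAs (AddCommGroup ↥(Ideal.span {fundIdempotent k R} : Ideal (PermutedOrders k E)))

instance (R : OrderOn E) : Module (PermutedOrders k E) (FundModule k R) :=
  inferInstanceAs (Module (PermutedOrders k E)
    ↥(Ideal.span {fundIdempotent k R} : Ideal (PermutedOrders k E)))

instance (R : OrderOn E) : Module k (FundModule k R) :=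
  inferInstanceAs (Module k ↥(Ideal.span {fundIdempotent k R} : Ideal (PermutedOrders k E)))

instance (R : OrderOn E) : IsScalarTower k (PermutedOrders k E) (FundModule k R) :=
  inferInstanceAs (IsScalarTower k (PermutedOrders k E)
    ↥(Ideal.span {fundIdempotent k R} : Ideal (PermutedOrders k E)))

/-- The fundamental module is a module over the algebra of relations on `E`, via the projection of
this algebra onto the algebra of permuted orders. -/
instance (R : OrderOn E) : Module (End (Free.of k E)) (FundModule k R) :=
  Module.compHom _ (toPermutedOrders k E).toRingHom

instance (R : OrderOn E) : IsScalarTower k (End (Free.of k E)) (FundModule k R) where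
  smul_assoc r a m := by
    change toPermutedOrders k E (r • a) • m = r • (toPermutedOrders k E a • m)
    rw [map_smul, smul_assoc]

/-- The element `f_R` of the fundamental module. -/
def fundGen (R : OrderOn E) : FundModule k R :=
  ⟨fundIdempotent k R, Ideal.subset_span rfl⟩

/-- The fundamental functor `𝕊_{E,R}`. -/
abbrev fundFunctor (R : OrderOn E) : CorrFunctor.{u} k :=
  (indRadical (Free.of k E) (FundModule k R)).quotient

instance (R : OrderOn E) : (fundFunctor k R).Additive := inferInstance

instance (R : OrderOn E) : (fundFunctor k R).Linear k := inferInstance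

/-- The canonical map from the fundamental module to the value at `E` of the fundamental functor,
sending `w` to the class of `Δ_E ⊗ w`. -/
def fundUnit (R : OrderOn E) : FundModule k R →ₗ[k] (fundFunctor k R).obj (Free.of k E) :=
  ((indRadical (Free.of k E) (FundModule k R)).proj.app (Free.of k E)).hom ∘ₗ
    indMk (Free.of k E) (FundModule k R) (Free.of k E) (𝟙 (Free.of k E))

end Fundamental

end

/-! ### Relations on a finite set -/

namespace FinCorr

/-! Everything rests on how a relation `V` on `D` acts on `f_Q`. By Hall's theorem `V` is
inessential unless it contains the graph of a permutation τ. Removing τ leaves a reflexive relation,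
which fixes `f_Q` if it is contained in `Q` and kills it otherwise. So `V f_Q` is Δ_τ `f_Q` when `V`
lies between Δ_τ and Δ_τ `Q` (`Fits`), and zero when there is no such τ. Equalities in the
fundamental functor thus reduce to comparing the permutations that relations fit
(`fundMk_eq_of_fits`).

On the lattice side, each element is the join of the irreducibles below it, so every map φ is
obtained from the parametrization `j` of the irreducibles by the relation `cone j φ`. Hence `j`
generates `F_T`, and φ ↦ `cone j φ` ⊗ `f_Q` is the only candidate for Θ. It is natural and kills
`H_T` because of the fits involved (`fits_cone_corrAct`, `not_fits_cone`). At the irreducibles, `F_T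
/ H_T` is a module over the permuted orders in which `f_Q` fixes `j`, and acting on `j` inverts the
induced map (`toFundBar_bijective`).

Given a surjection Φ, both functors vanish on sets smaller than their own `E` or `D`, while Φ(`j`)
and the generator of the target are nonzero; this forces equal cardinalities (`card_eq`). After
identifying the two sets, Φ(`j`) is a nonzero vector of the fundamental module of `Q` fixed by
`f_R`, where `R` is the opposite order of the irreducibles. Since `f_R` Δ_τ `f_Q` vanishes unless τ
carries `Q` to `R`, the posets are isomorphic (`eq_conj`). -/

/-- A relation that contains the graph of no permutation is inessential (marriage theorem of Hall). -/
lemma inessential_of_no_perm {D : FinCorr.{u}} (V : D ⟶ D)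
    (h : ¬ ∃ τ : Equiv.Perm D, ∀ d, (τ d, d) ∈ V.rel) : Inessential V := by
  classical
  have := Fintype.ofFinite D
  let t : D → Finset D := fun d => Finset.univ.filter fun a => (a, d) ∈ V.rel
  have ht : ¬ ∀ s : Finset D, s.card ≤ (s.biUnion t).card := by
    rw [Finset.all_card_le_biUnion_card_iff_exists_injective]
    rintro ⟨f, hf, hft⟩
    exact h ⟨Equiv.ofBijective f (Finite.injective_iff_bijective.1 hf), fun d => by
      simpa [t] using hft d⟩
  push Not at ht
  obtain ⟨s, hs⟩ := ht
  -- Hall's condition fails at `s`: its neighbourhood is smaller than `s`. Points of `s` are routed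
  -- through their neighbours, all other points through themselves.
  refine ⟨⟨{a // a ∈ s.biUnion t} ⊕ {d // d ∉ s}⟩,
    ⟨{p | Sum.elim (fun a => p.2 ∈ s ∧ (a.1, p.2) ∈ V.rel) (fun d => d.1 = p.2) p.1}⟩,
    ⟨{p | Sum.elim (fun a => p.1 = a.1) (fun d => (p.1, d.1) ∈ V.rel) p.2}⟩, ?_, ?_⟩
  · change Nat.card ({a // a ∈ s.biUnion t} ⊕ {d // d ∉ s}) < Nat.card D
    rw [Nat.card_sum, Nat.card_eq_fintype_card, Nat.card_eq_fintype_card,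
      Nat.card_eq_fintype_card, Fintype.card_coe, Fintype.card_subtype_compl, Fintype.card_coe]
    have := s.card_le_univ
    omega
  · apply Hom.ext
    ext ⟨a, b⟩
    constructor
    · intro hab
      by_cases hb : b ∈ s
      · exact ⟨Sum.inl ⟨a, Finset.mem_biUnion.2 ⟨b, hb, by simpa [t] using hab⟩⟩, rfl, hb, hab⟩
      · exact ⟨Sum.inr ⟨b, hb⟩, hab, rfl⟩
    · rintro ⟨y | y, h1, h2⟩
      · change a = y.1 at h1
        subst h1
        exact h2.2
      · change y.1 = b at h2
        subst h2
        exact h1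

/-- A preorder that is not an order is inessential. -/
lemma inessential_of_not_antisymm {D : FinCorr.{u}} (V : D ⟶ D) (hr : Reflexive V)
    (ht : ∀ a b c, (a, b) ∈ V.rel → (b, c) ∈ V.rel → (a, c) ∈ V.rel) {x y : D} (hxy : x ≠ y)
    (h1 : (x, y) ∈ V.rel) (h2 : (y, x) ∈ V.rel) : Inessential V := by
  -- `x` and `y` are equivalent under `V`, so `x` can stand in for `y` and `y` may be dropped.
  refine ⟨⟨{d : D // d ≠ y}⟩, ⟨{p | (p.1.1, p.2) ∈ V.rel}⟩, ⟨{p | (p.1, p.2.1) ∈ V.rel}⟩, ?_, ?_⟩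
  · exact Finite.card_subtype_lt (x := y) (by simp)
  · apply Hom.ext
    ext ⟨a, b⟩
    constructor
    · intro hab
      by_cases hb : b = y
      · subst hb
        exact ⟨⟨x, hxy⟩, ht _ _ _ hab h2, h1⟩
      · exact ⟨⟨b, hb⟩, hab, hr b⟩
    · rintro ⟨z, hz, hzb⟩
      exact ht _ _ _ hz hzb

/-- The graph of a permutation. -/
def ofPerm {D : FinCorr.{u}} (τ : Equiv.Perm D) : D ⟶ D := ⟨{p | p.1 = τ p.2}⟩

/-- The composite of a relation with the inverse of a permutation. -/
def untwist {D : FinCorr.{u}} (V : D ⟶ D) (τ : Equiv.Perm D) : D ⟶ D :=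
  ⟨{p | (τ p.1, p.2) ∈ V.rel}⟩

lemma eq_untwist_comp {D : FinCorr.{u}} (V : D ⟶ D) (τ : Equiv.Perm D) :
    V = untwist V τ ≫ ofPerm τ := by
  apply Hom.ext
  ext ⟨a, b⟩
  constructor
  · intro hab
    exact ⟨τ.symm a, by simp [ofPerm], by simpa [untwist] using hab⟩
  · rintro ⟨c, hc, hcb⟩
    change a = τ c at hc
    rw [hc]
    exact hcb

/-- The relation `V` lies between the graph of `τ` and its composite with the order `Q`. -/
def Fits {D : FinCorr.{u}} (Q : OrderOn D) (V : D ⟶ D) (τ : Equiv.Perm D) : Prop :=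
  (∀ d, (τ d, d) ∈ V.rel) ∧ ∀ a b, (τ a, b) ∈ V.rel → (a, b) ∈ Q.rel

end FinCorr

/-- The image of an order under a permutation. -/
def OrderOn.conj {X : Type u} (Q : OrderOn X) (τ : Equiv.Perm X) : OrderOn X where
  rel := {p | (τ.symm p.1, τ.symm p.2) ∈ Q.rel}
  refl _ := Q.refl _
  antisymm _ _ h h' := τ.symm.injective (Q.antisymm _ _ h h')
  trans _ _ _ h h' := Q.trans _ _ _ h h'

noncomputable section

/-! ### The algebra of permuted orders -/

section PermutedOrders

variable (k : Type v) [CommRing k] {D : FinCorr.{u}}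

/-- The class of a relation in the algebra of permuted orders. -/
def relClass (V : D ⟶ D) : PermutedOrders k D := toPermutedOrders k D (lin k V)

lemma relClass_mul (V U : D ⟶ D) : relClass k V * relClass k U = relClass k (U ≫ V) := by
  rw [relClass, relClass, relClass, ← map_mul, End.mul_def, lin_comp]

lemma relClass_of_inessential {V : D ⟶ D} (h : FinCorr.Inessential V) : relClass k V = 0 := by
  have := RingQuot.mkAlgHom_rel k (PermutedOrderRel.inessential (k := k) V h)
  rwa [map_zero] at this

lemma relClass_transClosure {V : D ⟶ D} (h : FinCorr.Reflexive V) :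
    relClass k V = relClass k (FinCorr.transClosure V) :=
  RingQuot.mkAlgHom_rel k (PermutedOrderRel.reflexive (k := k) V h)

open Classical in
lemma fundIdempotent_eq (R : OrderOn D) : fundIdempotent k R =
    ∑ S : OrderOn D with R ≤ S, IncidenceAlgebra.mu k R S • relClass k (FinCorr.ofOrder S) := rfl

open Classical in
/-- Möbius inversion for the definition of the idempotents `f_S`. -/
lemma relClass_ofOrder (R : OrderOn D) :
    relClass k (FinCorr.ofOrder R) = ∑ S : OrderOn D with R ≤ S, fundIdempotent k S := by
  simp only [fundIdempotent_eq]
  have h1 : ∀ S ∈ Finset.univ.filter (fun S : OrderOn D => R ≤ S),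
      ∑ S' : OrderOn D with S ≤ S', IncidenceAlgebra.mu k S S' • relClass k (FinCorr.ofOrder S') =
      ∑ S' : OrderOn D with R ≤ S', if S ≤ S' then
        IncidenceAlgebra.mu k S S' • relClass k (FinCorr.ofOrder S') else 0 := by
    intro S hS
    rw [← Finset.sum_filter, Finset.filter_filter]
    refine Finset.sum_congr ?_ fun _ _ => rfl
    ext S'
    simp only [Finset.mem_filter, Finset.mem_univ, true_and] at hS ⊢
    exact ⟨fun h => ⟨hS.trans h, h⟩, fun h => h.2⟩
  rw [Finset.sum_congr rfl h1, Finset.sum_comm]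
  have h2 : ∀ S' ∈ Finset.univ.filter (fun S : OrderOn D => R ≤ S),
      (∑ S : OrderOn D with R ≤ S, if S ≤ S' then
        IncidenceAlgebra.mu k S S' • relClass k (FinCorr.ofOrder S') else 0) =
      if R = S' then relClass k (FinCorr.ofOrder S') else 0 := by
    intro S' _
    rw [← Finset.sum_filter, Finset.filter_filter, ← Finset.sum_smul]
    have : (Finset.univ.filter fun S : OrderOn D => R ≤ S ∧ S ≤ S') = Finset.Icc R S' := by
      ext; simp
    rw [this, IncidenceAlgebra.sum_Icc_mu_left]
    split_ifs <;> simp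
  rw [Finset.sum_congr rfl h2, Finset.sum_ite_eq]
  simp

-- An order contains `V` exactly when it contains the transitive closure of `V`. If the closure is
-- an order, this is Möbius inversion; if not, the closure is inessential and the sum is empty.
open Classical in
lemma relClass_of_reflexive {V : D ⟶ D} (h : FinCorr.Reflexive V) :
    relClass k V = ∑ S : OrderOn D with V.rel ⊆ S.rel, fundIdempotent k S := by
  have hle (S : OrderOn D) (hS : V.rel ⊆ S.rel) : (FinCorr.transClosure V).rel ⊆ S.rel := by
    rintro ⟨a, b⟩ hab
    change Relation.TransGen _ a b at hab
    induction hab with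
    | single h => exact hS h
    | tail _ h ih => exact S.trans _ _ _ ih (hS h)
  have hV : V.rel ⊆ (FinCorr.transClosure V).rel := fun p hp => Relation.TransGen.single hp
  have ht : ∀ a b c, (a, b) ∈ (FinCorr.transClosure V).rel → (b, c) ∈ (FinCorr.transClosure V).rel →
      (a, c) ∈ (FinCorr.transClosure V).rel := fun a b c h h' => Relation.TransGen.trans h h'
  rw [relClass_transClosure k h]
  by_cases ha : ∀ a b, (a, b) ∈ (FinCorr.transClosure V).rel →
      (b, a) ∈ (FinCorr.transClosure V).rel → a = b
  · let C : OrderOn D := ⟨(FinCorr.transClosure V).rel, fun a => hV (h a), ha, ht⟩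
    change relClass k (FinCorr.ofOrder C) = _
    rw [relClass_ofOrder]
    refine Finset.sum_congr (Finset.filter_congr fun S _ => ?_) fun _ _ => rfl
    exact ⟨fun h => hV.trans h, hle S⟩
  · push Not at ha
    obtain ⟨a, b, h1, h2, hab⟩ := ha
    rw [relClass_of_inessential k
      (FinCorr.inessential_of_not_antisymm _ (fun a => hV (h a)) ht hab h1 h2),
      Finset.filter_false_of_mem, Finset.sum_empty]
    exact fun S _ hS => hab (S.antisymm _ _ (hle S hS h1) (hle S hS h2))

open Classical in
/-- The action of a reflexive relation on `f_R`. -/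
lemma relClass_mul_fundIdempotent {V : D ⟶ D} (h : FinCorr.Reflexive V) (R : OrderOn D) :
    relClass k V * fundIdempotent k R = if V.rel ⊆ R.rel then fundIdempotent k R else 0 := by
  -- Descending induction: the product of `V` and `R` is expanded in two ways, as a reflexive
  -- relation and through `R` = ∑ `f_S`. The terms with `S` strictly above `R` agree by induction
  -- and cancel.
  induction R using WellFoundedGT.induction with
  | _ R ih =>
  have hsplit : (Finset.univ.filter fun S : OrderOn D => R ≤ S) =
      insert R (Finset.univ.filter fun S : OrderOn D => R < S) := by
    ext S
    simp only [Finset.mem_filter, Finset.mem_univ, true_and, Finset.mem_insert]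
    rw [le_iff_eq_or_lt, eq_comm]
  have hR : R ∉ Finset.univ.filter fun S : OrderOn D => R < S := by simp
  have h1 : relClass k V * relClass k (FinCorr.ofOrder R) =
      ∑ S : OrderOn D with R ≤ S, if V.rel ⊆ S.rel then fundIdempotent k S else 0 := by
    rw [relClass_mul, relClass_of_reflexive, ← Finset.sum_filter, Finset.filter_filter]
    · refine Finset.sum_congr (Finset.filter_congr fun S _ => ?_) fun _ _ => rfl
      constructor
      · exact fun hS => ⟨fun p hp => hS ⟨p.1, h _, hp⟩, fun p hp => hS ⟨p.2, hp, R.refl _⟩⟩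
      · rintro ⟨hRS, hVS⟩ ⟨a, b⟩ ⟨c, hc, hc'⟩
        exact S.trans _ _ _ (hVS hc) (hRS hc')
    · exact fun a => ⟨a, h a, R.refl a⟩
  rw [relClass_ofOrder, hsplit, Finset.sum_insert hR, Finset.sum_insert hR, mul_add,
    Finset.mul_sum, Finset.sum_congr rfl fun S hS => ih S (Finset.mem_filter.1 hS).2] at h1
  exact add_right_cancel h1

/-- `V` is Δ_τ times a reflexive relation contained in `Q`, and `f_Q` absorbs the latter. -/
lemma relClass_mul_fundIdempotent_of_fits {Q : OrderOn D} {V : D ⟶ D} {τ : Equiv.Perm D}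
    (h : FinCorr.Fits Q V τ) : relClass k V * fundIdempotent k Q =
      relClass k (FinCorr.ofPerm τ) * fundIdempotent k Q := by
  classical
  have hV : FinCorr.Reflexive (FinCorr.untwist V τ) := h.1
  rw [FinCorr.eq_untwist_comp V τ, ← relClass_mul, mul_assoc, relClass_mul_fundIdempotent k hV,
    if_pos]
  exact fun p hp => h.2 p.1 p.2 hp

lemma exists_fits {Q : OrderOn D} {V : D ⟶ D}
    (h : relClass k V * fundIdempotent k Q ≠ 0) : ∃ τ, FinCorr.Fits Q V τ := by
  classical
  by_cases hp : ∃ τ : Equiv.Perm D, ∀ d, (τ d, d) ∈ V.rel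
  · obtain ⟨τ, hτ⟩ := hp
    refine ⟨τ, hτ, ?_⟩
    have hV : FinCorr.Reflexive (FinCorr.untwist V τ) := hτ
    rw [FinCorr.eq_untwist_comp V τ, ← relClass_mul, mul_assoc,
      relClass_mul_fundIdempotent k hV] at h
    by_contra hn
    apply h
    rw [if_neg, mul_zero]
    exact fun hs => hn fun a b hab => hs (a := (a, b)) hab
  · exact absurd (by rw [relClass_of_inessential k (FinCorr.inessential_of_no_perm V hp), zero_mul]) h

/-- Relations fitting the same permutations act in the same way on `f_Q`. -/
lemma relClass_mul_fundIdempotent_congr {Q : OrderOn D} {U V : D ⟶ D}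
    (h : ∀ τ, FinCorr.Fits Q U τ ↔ FinCorr.Fits Q V τ) :
    relClass k U * fundIdempotent k Q = relClass k V * fundIdempotent k Q := by
  by_cases hU : ∃ τ, FinCorr.Fits Q U τ
  · obtain ⟨τ, hτ⟩ := hU
    rw [relClass_mul_fundIdempotent_of_fits k hτ,
      relClass_mul_fundIdempotent_of_fits k ((h τ).1 hτ)]
  · have hV : ¬ ∃ τ, FinCorr.Fits Q V τ := fun ⟨τ, hτ⟩ => hU ⟨τ, (h τ).2 hτ⟩
    rw [not_imp_comm.1 (exists_fits k) hU, not_imp_comm.1 (exists_fits k) hV]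

/-- Moved past τ, an order `S` acts on Δ_τ `f_Q` as the identity if it is contained in `Q.conj τ`
and as zero otherwise. So `f_R` acts by a sum of Möbius values over an interval, which vanishes
unless its endpoints coincide. -/
lemma eq_conj_of_mul_ne_zero {R Q : OrderOn D} {τ : Equiv.Perm D}
    (h : fundIdempotent k R * (relClass k (FinCorr.ofPerm τ) * fundIdempotent k Q) ≠ 0) :
    R = Q.conj τ := by
  classical
  by_contra hne
  apply h
  have hact (S : OrderOn D) : relClass k (FinCorr.ofOrder S) *
      (relClass k (FinCorr.ofPerm τ) * fundIdempotent k Q) =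
      if S ≤ Q.conj τ then relClass k (FinCorr.ofPerm τ) * fundIdempotent k Q else 0 := by
    let S' : D ⟶ D := ⟨{p | (τ p.1, τ p.2) ∈ S.rel}⟩
    have hS : FinCorr.ofPerm τ ≫ FinCorr.ofOrder S = S' ≫ FinCorr.ofPerm τ := by
      apply FinCorr.Hom.ext
      ext ⟨a, b⟩
      constructor
      · rintro ⟨c, hc, hc'⟩
        change c = τ b at hc'
        subst hc'
        exact ⟨τ.symm a, by simp [FinCorr.ofPerm], by simpa [S', FinCorr.ofOrder] using hc⟩
      · rintro ⟨c, hc, hc'⟩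
        change a = τ c at hc
        subst hc
        exact ⟨τ b, hc', rfl⟩
    rw [← mul_assoc, relClass_mul, hS, ← relClass_mul, mul_assoc,
      relClass_mul_fundIdempotent k (V := S') (fun a => S.refl _), mul_ite, mul_zero]
    refine if_congr ?_ rfl rfl
    constructor
    · rintro hs ⟨a, b⟩ hab
      exact hs (a := (τ.symm a, τ.symm b)) (by simpa [S'] using hab)
    · rintro hs ⟨a, b⟩ hab
      simpa [OrderOn.conj] using hs hab
  rw [fundIdempotent_eq, Finset.sum_mul]
  simp only [smul_mul_assoc, hact, smul_ite, smul_zero]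
  rw [← Finset.sum_filter, Finset.filter_filter, ← Finset.sum_smul]
  have : (Finset.univ.filter fun S : OrderOn D => R ≤ S ∧ S ≤ Q.conj τ) =
      Finset.Icc R (Q.conj τ) := by
    ext; simp
  rw [this, IncidenceAlgebra.sum_Icc_mu_right, if_neg hne, zero_smul]

end PermutedOrders
end
noncomputable section

/-! ### Fundamental modules and functors -/

section FundFunctor

variable (k : Type v) [CommRing k] {D : FinCorr.{u}} (Q : OrderOn D)

/-- The inclusion of the fundamental module in the algebra of permuted orders. -/
def fundVal : FundModule k Q →ₗ[k] PermutedOrders k D :=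
  (Ideal.span {fundIdempotent k Q} : Ideal (PermutedOrders k D)).subtype.restrictScalars k

lemma fundVal_injective : Function.Injective (fundVal k Q) := Subtype.val_injective

lemma fundVal_smul (a : End (Free.of k D)) (w : FundModule k Q) :
    fundVal k Q (a • w) = toPermutedOrders k D a * fundVal k Q w := rfl

lemma fundVal_fundGen : fundVal k Q (fundGen k Q) = fundIdempotent k Q := rfl

lemma exists_smul_fundGen (w : FundModule k Q) :
    ∃ a : End (Free.of k D), w = a • fundGen k Q := by
  obtain ⟨b, hb⟩ := Ideal.mem_span_singleton'.1 w.2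
  obtain ⟨a, rfl⟩ := RingQuot.mkAlgHom_surjective k (PermutedOrderRel k D) b
  exact ⟨a, fundVal_injective k Q hb.symm⟩

/-- The class in the fundamental functor of the tensor `φ ⊗ w`. -/
def fundMk (X : LinCorr.{u} k) :
    (Free.of k D ⟶ X) →ₗ[k] FundModule k Q →ₗ[k] (fundFunctor k Q).obj X :=
  (indMk (Free.of k D) (FundModule k Q) X).compr₂
    ((indRadical (Free.of k D) (FundModule k Q)).proj.app X).hom

lemma map_fundMk {X Y : LinCorr.{u} k} (α : X ⟶ Y) (φ : Free.of k D ⟶ X) (w : FundModule k Q) :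
    ((fundFunctor k Q).map α).hom (fundMk k Q X φ w) = fundMk k Q Y (φ ≫ α) w := rfl

lemma fundUnit_eq_fundMk (w : FundModule k Q) :
    fundUnit k Q w = fundMk k Q (Free.of k D) (𝟙 (Free.of k D)) w := rfl

lemma fundMk_comp {X : LinCorr.{u} k} (a : End (Free.of k D)) (φ : Free.of k D ⟶ X)
    (w : FundModule k Q) : fundMk k Q X (a ≫ φ) w = fundMk k Q X φ (a • w) := by
  have h : indMk (Free.of k D) (FundModule k Q) X (a ≫ φ) w =
      indMk (Free.of k D) (FundModule k Q) X φ (a • w) :=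
    (Submodule.Quotient.eq _).2 (Submodule.subset_span ⟨φ, a, w, rfl⟩)
  exact congrArg ((indRadical (Free.of k D) (FundModule k Q)).proj.app X).hom h

@[elab_as_elim]
lemma fundMk_induction {X : LinCorr.{u} k} {p : (fundFunctor k Q).obj X → Prop}
    (h : ∀ φ w, p (fundMk k Q X φ w)) (hadd : ∀ x y, p x → p y → p (x + y))
    (x : (fundFunctor k Q).obj X) : p x := by
  obtain ⟨x, rfl⟩ := Submodule.mkQ_surjective _ x
  obtain ⟨x, rfl⟩ := Submodule.mkQ_surjective _ x
  induction x using TensorProduct.induction_on with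
  | zero =>
    have := h 0 0
    rw [map_zero] at this
    exact this
  | tmul φ w => exact h φ w
  | add x y hx hy =>
    exact hadd _ _ hx hy

/-- The evaluation maps defining the radical, as a linear map. -/
def indEvalHom (E : LinCorr.{u} k) (W : Type (max u v)) [AddCommGroup W] [Module k W]
    [Module (End E) W] [IsScalarTower k (End E) W] (X : LinCorr.{u} k) :
    (X ⟶ E) →ₗ[k] (indFunctor E W).obj X →ₗ[k] W where
  toFun := indEval E W X
  map_add' ψ ψ' := by
    refine Submodule.linearMap_qext _ (TensorProduct.ext' fun φ w => ?_)
    change End.of (φ ≫ (ψ + ψ')) • w = End.of (φ ≫ ψ) • w + End.of (φ ≫ ψ') • w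
    rw [Preadditive.comp_add, ← add_smul]
  map_smul' r ψ := by
    refine Submodule.linearMap_qext _ (TensorProduct.ext' fun φ w => ?_)
    change End.of (φ ≫ (r • ψ)) • w = r • End.of (φ ≫ ψ) • w
    rw [Linear.comp_smul, ← smul_assoc]

/-- Evaluation is linear in ψ, so the radical can be tested on relations instead of on their linear
combinations. -/
lemma proj_eq_zero {X : FinCorr.{u}}
    {x : (indFunctor (Free.of k D) (FundModule k Q)).obj (Free.of k X)}
    (h : ∀ ψ : X ⟶ D, indEval (Free.of k D) (FundModule k Q) (Free.of k X) (lin k ψ) x = 0) :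
    ((indRadical (Free.of k D) (FundModule k Q)).proj.app (Free.of k X)).hom x = 0 := by
  refine (Submodule.Quotient.mk_eq_zero _).2 ((Submodule.mem_iInf _).2 fun ψ => ?_)
  have H : (indEvalHom k (Free.of k D) (FundModule k Q) (Free.of k X)).flip x = 0 :=
    lin_hom_ext fun ψ => h ψ
  exact LinearMap.congr_fun H ψ

-- The radical only sees the actions of the composites with ψ on `f_Q`, and these depend only on the
-- permutations that fit.
variable {k Q} in
lemma fundMk_eq_of_fits {X : FinCorr.{u}} {φ φ' : D ⟶ X}
    (h : ∀ (ψ : X ⟶ D) (τ : Equiv.Perm D),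
      FinCorr.Fits Q (φ ≫ ψ) τ ↔ FinCorr.Fits Q (φ' ≫ ψ) τ) :
    fundMk k Q (Free.of k X) (lin k φ) (fundGen k Q) =
      fundMk k Q (Free.of k X) (lin k φ') (fundGen k Q) := by
  rw [← sub_eq_zero, ← LinearMap.sub_apply, ← map_sub]
  refine proj_eq_zero k Q fun ψ => ?_
  rw [indEval_indMk, Preadditive.sub_comp, ← lin_comp, ← lin_comp]
  apply fundVal_injective k Q
  rw [fundVal_smul, map_zero, fundVal_fundGen]
  change toPermutedOrders k D (lin k (φ ≫ ψ) - lin k (φ' ≫ ψ)) * _ = 0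
  rw [map_sub, sub_mul, sub_eq_zero]
  exact relClass_mul_fundIdempotent_congr k (h ψ)

variable {k Q} in
lemma fundMk_eq_zero_of_not_fits {X : FinCorr.{u}} {φ : D ⟶ X}
    (h : ∀ (ψ : X ⟶ D) (τ : Equiv.Perm D), ¬ FinCorr.Fits Q (φ ≫ ψ) τ) :
    fundMk k Q (Free.of k X) (lin k φ) (fundGen k Q) = 0 := by
  refine proj_eq_zero k Q fun ψ => ?_
  rw [indEval_indMk, ← lin_comp]
  apply fundVal_injective k Q
  rw [fundVal_smul, map_zero, fundVal_fundGen]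
  by_contra hne
  obtain ⟨τ, hτ⟩ := exists_fits k (V := φ ≫ ψ) hne
  exact h ψ τ hτ

/-- The fundamental functor vanishes on sets with less than `|D|` elements. -/
lemma fundFunctor_eq_zero {X : FinCorr.{u}} (hX : Nat.card X < Nat.card D)
    (x : (fundFunctor k Q).obj (Free.of k X)) : x = 0 := by
  induction x using fundMk_induction with
  | hadd x y hx hy => rw [hx, hy, add_zero]
  | h φ w =>
    obtain ⟨a, rfl⟩ := exists_smul_fundGen k Q w
    rw [← fundMk_comp]
    have H : (fundMk k Q (Free.of k X)).flip (fundGen k Q) = 0 := by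
      refine lin_hom_ext fun φ => fundMk_eq_zero_of_not_fits fun ψ τ hτ => ?_
      -- `g d` is a point of `X` through which `(τ d, d)` factors. If `g d = g d'`, then `(τ d, d')`
      -- and `(τ d', d)` factor too, so `d` and `d'` are comparable both ways in `Q`.
      choose g hg hg' using hτ.1
      refine hX.not_ge (Nat.card_le_card_of_injective g fun d d' hd => ?_)
      refine Q.antisymm _ _ (hτ.2 _ _ ⟨g d, hg d, ?_⟩) (hτ.2 _ _ ⟨g d', hg d', ?_⟩)
      · rw [hd]
        exact hg' d'
      · rw [← hd]
        exact hg' d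
    exact LinearMap.congr_fun H (a ≫ φ)

/-- The map sending the class of `φ ⊗ w` to `φ • w`. -/
def fundCounit : (fundFunctor k Q).obj (Free.of k D) →ₗ[k] FundModule k Q :=
  ((indRadical (Free.of k D) (FundModule k Q)).obj (Free.of k D)).liftQ
    (indEval (Free.of k D) (FundModule k Q) (Free.of k D) (𝟙 (Free.of k D)))
    fun _ hx => (Submodule.mem_iInf _).1 hx _

lemma fundCounit_fundMk (φ : End (Free.of k D)) (w : FundModule k Q) :
    fundCounit k Q (fundMk k Q (Free.of k D) φ w) = φ • w := by
  change End.of (φ ≫ 𝟙 _) • w = φ • w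
  rw [Category.comp_id]

lemma fundUnit_bijective : Function.Bijective (fundUnit k Q) := by
  constructor
  · refine Function.LeftInverse.injective (g := fundCounit k Q) fun w => ?_
    rw [fundUnit_eq_fundMk, fundCounit_fundMk]
    exact one_smul _ w
  · intro x
    induction x using fundMk_induction with
    | h φ w =>
      refine ⟨End.of φ • w, ?_⟩
      rw [fundUnit_eq_fundMk, ← fundMk_comp, Category.comp_id]
    | hadd x y hx hy =>
      obtain ⟨a, rfl⟩ := hx
      obtain ⟨b, rfl⟩ := hy
      exact ⟨a + b, map_add _ _ _⟩

lemma fundUnit_smul (a : End (Free.of k D)) (w : FundModule k Q) :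
    fundUnit k Q (a • w) = ((fundFunctor k Q).map a).hom (fundUnit k Q w) := by
  rw [fundUnit_eq_fundMk, fundUnit_eq_fundMk, map_fundMk, ← fundMk_comp, Category.comp_id,
    Category.id_comp]

end FundFunctor
end
noncomputable section

/-! ### The quotient of a lattice functor by its non-full part -/

section LatticeQuotient

/-- If a permutation increases the values of an injective map to a partially ordered set, then it
is trivial. -/
lemma Equiv.Perm.apply_eq_of_le {D T : Type*} [Finite D] [PartialOrder T] {f : D → T}
    (hf : Function.Injective f) {π : Equiv.Perm D} (h : ∀ d, f d ≤ f (π d)) (d : D) : π d = d := by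
  have hpow (n : ℕ) (d : D) : f d ≤ f ((π ^ n) d) := by
    induction n with
    | zero => simp
    | succ n ih =>
      rw [pow_succ']
      exact ih.trans (h _)
  refine hf (le_antisymm ?_ (h d))
  -- Going around the cycle of `d` leads from `π d` back to `d`.
  have h1 := hpow (orderOf π - 1) (π d)
  rwa [← Equiv.Perm.mul_apply, ← pow_succ, Nat.sub_add_cancel (orderOf_pos π), pow_orderOf_eq_one,
    Equiv.Perm.one_apply] at h1

variable (k : Type v) [CommRing k] {T : Type u} [Lattice T]

/-- The map `j` identifies `D` with the set of irreducible elements of `T`, and `Q` with the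
opposite of its order. -/
structure IrrParam {D : FinCorr.{u}} (Q : OrderOn D) (j : D → T) : Prop where
  injective : Function.Injective j
  supIrred_iff : ∀ t, SupIrred t ↔ ∃ d, j d = t
  mem_iff : ∀ a b, (a, b) ∈ Q.rel ↔ j b ≤ j a

namespace IrrParam

variable {D : FinCorr.{u}} {Q : OrderOn D} {j : D → T}

lemma supIrred (hj : IrrParam Q j) (d : D) : SupIrred (j d) := (hj.supIrred_iff _).2 ⟨d, rfl⟩

lemma full (hj : IrrParam Q j) : {e : T | SupIrred e} ⊆ Set.range j :=
  fun e he => (hj.supIrred_iff e).1 he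

lemma exists_injective (hj : IrrParam Q j) {X : FinCorr.{u}} {φ : X → T}
    (h : {e : T | SupIrred e} ⊆ Set.range φ) :
    ∃ g : D → X, Function.Injective g ∧ ∀ d, φ (g d) = j d := by
  choose g hg using fun d => h (hj.supIrred d)
  refine ⟨g, fun d d' hd => hj.injective ?_, hg⟩
  rw [← hg, ← hg, hd]

lemma exists_perm (hj : IrrParam Q j) {φ : D → T} (h : {e : T | SupIrred e} ⊆ Set.range φ) :
    ∃ σ : Equiv.Perm D, ∀ d, φ d = j (σ d) := by
  obtain ⟨g, hg, hφ⟩ := hj.exists_injective h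
  refine ⟨(Equiv.ofBijective g (Finite.injective_iff_bijective.1 hg)).symm, fun d => ?_⟩
  rw [← hφ]
  exact congrArg φ ((Equiv.ofBijective g _).apply_symm_apply d).symm

end IrrParam

variable [BoundedOrder T]
/-- The class of a map `φ : X → T` in the quotient of `F_T` by its non-full part. -/
def latMk {X : FinCorr.{u}} (φ : X → T) : (nonFull k T).quotient.obj (Free.of k X) :=
  (nonFullSubmodule k T X).mkQ (Finsupp.single φ 1)

lemma map_latMk {X Y : FinCorr.{u}} (S : X ⟶ Y) (φ : X → T) :
    ((nonFull k T).quotient.map (lin k S)).hom (latMk k φ) = latMk k (corrAct S φ) := by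
  change (nonFullSubmodule k T Y).mkQ (latticeMap k T X Y (lin k S) (Finsupp.single φ 1)) = _
  rw [latticeMap_lin, Finsupp.lmapDomain_apply, Finsupp.mapDomain_single]
  rfl

lemma latMk_eq_zero {X : FinCorr.{u}} {φ : X → T} (h : ¬ {e : T | SupIrred e} ⊆ Set.range φ) :
    latMk k φ = 0 :=
  (Submodule.Quotient.mk_eq_zero _).2 (Submodule.subset_span ⟨φ, h, rfl⟩)

lemma latMk_ne_zero [Nontrivial k] {X : FinCorr.{u}} {φ : X → T}
    (h : {e : T | SupIrred e} ⊆ Set.range φ) : latMk k φ ≠ 0 := by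
  intro h0
  have hle : nonFullSubmodule k T X ≤ LinearMap.ker (Finsupp.lapply φ) := by
    refine Submodule.span_le.2 ?_
    rintro _ ⟨φ', hφ', rfl⟩
    have hne : φ' ≠ φ := by
      rintro rfl
      exact hφ' h
    simp [Finsupp.single_eq_of_ne' hne]
  have h1 := hle ((Submodule.Quotient.mk_eq_zero _).1 h0)
  simp at h1

lemma latticeQuotient_hom_ext {X : FinCorr.{u}} {W : Type w} [AddCommGroup W] [Module k W]
    {f g : (nonFull k T).quotient.obj (Free.of k X) →ₗ[k] W}
    (h : ∀ φ : X → T, f (latMk k φ) = g (latMk k φ)) : f = g :=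
  Submodule.linearMap_qext _ (Finsupp.lhom_ext' fun φ => LinearMap.ext_ring (h φ))

lemma le_corrAct {X Y : FinCorr.{u}} {S : X ⟶ Y} {x : X} {y : Y} (h : (y, x) ∈ S.rel)
    (φ : X → T) : φ x ≤ corrAct S φ y :=
  Finset.le_sup (f := φ) ((Set.Finite.mem_toFinset _).2 h)

lemma corrAct_le {X Y : FinCorr.{u}} {S : X ⟶ Y} {φ : X → T} {y : Y} {t : T}
    (h : ∀ x, (y, x) ∈ S.rel → φ x ≤ t) : corrAct S φ y ≤ t :=
  Finset.sup_le fun x hx => h x (by simpa using hx)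

lemma exists_of_corrAct_eq {X Y : FinCorr.{u}} {S : X ⟶ Y} {φ : X → T} {y : Y} {t : T}
    (ht : SupIrred t) (h : corrAct S φ y = t) : ∃ x, (y, x) ∈ S.rel ∧ φ x = t := by
  obtain ⟨x, hx, h⟩ := ht.finset_sup_eq h
  exact ⟨x, by simpa using hx, h⟩

variable (T) in
/-- The action of the algebra of relations on the value at `D` of the quotient. -/
def endAction (D : FinCorr.{u}) : End (Free.of k D) →ₐ[k]
    Module.End k ((nonFull k T).quotient.obj (Free.of k D)) :=
  AlgHom.ofLinearMap
    { toFun := fun a => ((nonFull k T).quotient.map a).hom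
      map_add' := fun a b => by rw [Functor.map_add]; rfl
      map_smul' := fun r a => by rw [Functor.map_smul]; rfl }
    (congrArg ModuleCat.Hom.hom ((nonFull k T).quotient.map_id (Free.of k D)))
    (fun a b => congrArg ModuleCat.Hom.hom ((nonFull k T).quotient.map_comp b a))

open Classical in
/-- A preimage of `f_Q` in the algebra of relations. -/
def fundLift {D : FinCorr.{u}} (Q : OrderOn D) : End (Free.of k D) :=
  ∑ S : OrderOn D with Q ≤ S, IncidenceAlgebra.mu k Q S • End.of (lin k (FinCorr.ofOrder S))

lemma toPermutedOrders_fundLift {D : FinCorr.{u}} (Q : OrderOn D) :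
    toPermutedOrders k D (fundLift k Q) = fundIdempotent k Q := by
  rw [fundLift, map_sum]
  simp only [map_smul]
  rfl

/-- The relation consisting of all `(x, d)` such that `j d ≤ φ x`. -/
def cone {X D : FinCorr.{u}} (j : D → T) (φ : X → T) : D ⟶ X := ⟨{p | j p.2 ≤ φ p.1}⟩

namespace IrrParam

variable {D : FinCorr.{u}} {Q : OrderOn D} {j : D → T}

/-- Both maps list the irreducibles once each, so they differ by a permutation. As `S` is reflexive,
its action can only increase values, which makes this permutation trivial. -/
lemma corrAct_eq_self (hj : IrrParam Q j) {S : D ⟶ D} (hS : FinCorr.Reflexive S) {φ : D → T}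
    (h : {e : T | SupIrred e} ⊆ Set.range φ)
    (h' : {e : T | SupIrred e} ⊆ Set.range (corrAct S φ)) : corrAct S φ = φ := by
  obtain ⟨σ, hσ⟩ := hj.exists_perm h
  obtain ⟨σ', hσ'⟩ := hj.exists_perm h'
  have hφ : Function.Injective φ := fun a b hab => by
    rw [hσ, hσ] at hab
    exact σ.injective (hj.injective hab)
  have hval (d : D) : φ ((σ'.trans σ.symm) d) = corrAct S φ d := by
    rw [hσ, hσ', Equiv.trans_apply, Equiv.apply_symm_apply]
  funext d
  rw [← hval, Equiv.Perm.apply_eq_of_le hφ (π := σ'.trans σ.symm)]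
  exact fun d => (le_corrAct (hS d) φ).trans_eq (hval d).symm

-- A reflexive relation either fixes a full map or sends it into `H_T`: the same dichotomy as for
-- its action on `f_Q`, which is why the permuted orders act here.
open Classical in
lemma map_latMk_of_reflexive (hj : IrrParam Q j) {S : D ⟶ D} (hS : FinCorr.Reflexive S) {φ : D → T}
    (h : {e : T | SupIrred e} ⊆ Set.range φ) :
    ((nonFull k T).quotient.map (lin k S)).hom (latMk k φ) =
      if ∀ x y, (x, y) ∈ S.rel → φ y ≤ φ x then latMk k φ else 0 := by
  rw [map_latMk]
  split_ifs with hc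
  · congr 1
    funext d
    exact le_antisymm (corrAct_le fun x hx => hc _ _ hx) (le_corrAct (hS d) φ)
  · refine latMk_eq_zero k fun h' => hc fun x y hxy => ?_
    have := le_corrAct hxy φ
    rwa [hj.corrAct_eq_self hS h h'] at this

lemma latticeQuotient_eq_zero (hj : IrrParam Q j) {X : FinCorr.{u}} (hX : Nat.card X < Nat.card D)
    (x : (nonFull k T).quotient.obj (Free.of k X)) : x = 0 := by
  have H : (LinearMap.id : _ →ₗ[k] (nonFull k T).quotient.obj (Free.of k X)) = 0 := by
    refine latticeQuotient_hom_ext k fun φ => latMk_eq_zero k fun h => ?_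
    obtain ⟨g, hg, -⟩ := hj.exists_injective h
    exact hX.not_ge (Nat.card_le_card_of_injective g hg)
  exact LinearMap.congr_fun H x

/-- The value at `D` of the quotient is a module over the algebra of permuted orders. -/
def orderAction (hj : IrrParam Q j) : PermutedOrders k D →ₐ[k]
    Module.End k ((nonFull k T).quotient.obj (Free.of k D)) :=
  RingQuot.liftAlgHom k ⟨endAction k T D, by
    classical
    -- An inessential relation acts through the value at a smaller set, which is zero. For a
    -- reflexive `S`, the condition for fixing φ is transitive, so it is the same for `S` and its
    -- closure.
    rintro _ _ (⟨S, Y, V, U, hY, rfl⟩ | ⟨S, hS⟩)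
    · refine latticeQuotient_hom_ext k fun φ => ?_
      rw [lin_comp]
      change ((nonFull k T).quotient.map (lin k V ≫ lin k U)).hom (latMk k φ) = _
      rw [Functor.map_comp, ModuleCat.hom_comp, LinearMap.comp_apply,
        hj.latticeQuotient_eq_zero k hY (((nonFull k T).quotient.map (lin k V)).hom (latMk k φ)),
        map_zero, map_zero]
      rfl
    · refine latticeQuotient_hom_ext k fun φ => ?_
      change ((nonFull k T).quotient.map (lin k S)).hom (latMk k φ) =
        ((nonFull k T).quotient.map (lin k (FinCorr.transClosure S))).hom (latMk k φ)
      by_cases h : {e : T | SupIrred e} ⊆ Set.range φ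
      · rw [hj.map_latMk_of_reflexive k hS h,
          hj.map_latMk_of_reflexive k (S := FinCorr.transClosure S)
            (fun a => Relation.TransGen.single (hS a)) h]
        refine if_congr ⟨fun hc x y hxy => ?_, fun hc x y hxy =>
          hc x y (Relation.TransGen.single hxy)⟩ rfl rfl
        change Relation.TransGen _ x y at hxy
        induction hxy with
        | single h => exact hc _ _ h
        | tail _ h ih => exact (hc _ _ h).trans ih
      · rw [latMk_eq_zero k h, map_zero, map_zero]⟩

lemma orderAction_toPermutedOrders (hj : IrrParam Q j) (a : End (Free.of k D)) :
    hj.orderAction k (toPermutedOrders k D a) = endAction k T D a :=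
  RingQuot.liftAlgHom_mkAlgHom_apply k _ _ _

/-- An order fixes `j` only if it is contained in `Q`, and kills it otherwise. Among the orders
containing `Q` only `Q` itself survives, with coefficient 1. -/
lemma endAction_fundLift (hj : IrrParam Q j) :
    endAction k T D (fundLift k Q) (latMk k j) = latMk k j := by
  classical
  rw [fundLift, map_sum, LinearMap.sum_apply, Finset.sum_eq_single Q]
  · rw [map_smul, LinearMap.smul_apply, IncidenceAlgebra.mu_self, one_smul]
    refine (hj.map_latMk_of_reflexive k (S := FinCorr.ofOrder Q) Q.refl hj.full).trans
      (if_pos fun x y h => ?_)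
    exact (hj.mem_iff _ _).1 h
  · intro S hS hne
    rw [map_smul, LinearMap.smul_apply]
    have : endAction k T D (End.of (lin k (FinCorr.ofOrder S))) (latMk k j) = 0 := by
      refine (hj.map_latMk_of_reflexive k (S := FinCorr.ofOrder S) S.refl hj.full).trans
        (if_neg fun hc => hne ?_)
      exact le_antisymm (fun p hp => (hj.mem_iff _ _).2 (hc _ _ hp)) (Finset.mem_filter.1 hS).2
    rw [this, smul_zero]
  · simp

lemma orderAction_fundIdempotent (hj : IrrParam Q j) :
    hj.orderAction k (fundIdempotent k Q) (latMk k j) = latMk k j := by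
  rw [← toPermutedOrders_fundLift, orderAction_toPermutedOrders]
  exact hj.endAction_fundLift k

lemma fundIdempotent_ne_zero (hj : IrrParam Q j) [Nontrivial k] : fundIdempotent k Q ≠ 0 := by
  intro h
  have := hj.orderAction_fundIdempotent k
  rw [h, map_zero] at this
  exact latMk_ne_zero k hj.full this.symm

end IrrParam

end LatticeQuotient

/-- The order idempotents are nonzero: every finite poset is the poset of irreducible elements of a
finite lattice. -/
lemma fundIdempotent_ne_zero (k : Type v) [CommRing k] [Nontrivial k] {D : FinCorr.{u}}
    (Q : OrderOn D) : fundIdempotent k Q ≠ 0 := by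
  -- The order opposite to `Q`, because `IrrParam` reverses the order. The irreducible lower sets of
  -- a finite poset are the principal ones.
  let _ : PartialOrder D :=
    { le := fun a b => (b, a) ∈ Q.rel
      le_refl := Q.refl
      le_trans := fun a b c h h' => Q.trans _ _ _ h' h
      le_antisymm := fun a b h h' => Q.antisymm _ _ h' h }
  have hj : IrrParam Q (LowerSet.Iic : D → LowerSet D) :=
    ⟨LowerSet.Iic_injective, fun _ => LowerSet.supIrred_iff_of_finite,
      fun a b => LowerSet.Iic_le (s := LowerSet.Iic a) (a := b) |>.symm⟩
  exact hj.fundIdempotent_ne_zero k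

end
noncomputable section

/-! ### The morphism from a lattice functor to a fundamental functor -/

namespace IrrParam

variable (k : Type v) [CommRing k] {T : Type u} [Lattice T]
  {D : FinCorr.{u}} {Q : OrderOn D} {j : D → T}

lemma cone_self (hj : IrrParam Q j) : cone j j = FinCorr.ofOrder Q := by
  apply FinCorr.Hom.ext
  ext ⟨a, b⟩
  exact (hj.mem_iff a b).symm

variable (Q j) in
/-- The map sending `φ` to the class of `cone j φ ⊗ f_Q`. -/
def toFundMap (X : FinCorr.{u}) :
    ((X → T) →₀ k) →ₗ[k] (fundFunctor k Q).obj (Free.of k X) :=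
  Finsupp.linearCombination k
    fun φ : X → T => fundMk k Q (Free.of k X) (lin k (cone j φ)) (fundGen k Q)

lemma toFundMap_single {X : FinCorr.{u}} (φ : X → T) :
    toFundMap k Q j X (Finsupp.single φ 1) =
      fundMk k Q (Free.of k X) (lin k (cone j φ)) (fundGen k Q) := by
  rw [toFundMap, Finsupp.linearCombination_single, one_smul]

variable [BoundedOrder T]

lemma le_of_forall_le [Finite T] (hj : IrrParam Q j) {s t : T} (h : ∀ d, j d ≤ s → j d ≤ t) :
    s ≤ t := by
  obtain ⟨A, rfl, hA⟩ := exists_supIrred_decomposition s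
  refine Finset.sup_le fun a ha => ?_
  obtain ⟨d, rfl⟩ := (hj.supIrred_iff a).1 (hA ha)
  exact h d (Finset.le_sup (f := id) ha)

/-- Each value of φ is the join of the irreducibles below it; hence `j` generates `F_T`. -/
lemma corrAct_cone [Finite T] (hj : IrrParam Q j) {X : FinCorr.{u}} (φ : X → T) :
    corrAct (cone j φ) j = φ := by
  funext x
  exact le_antisymm (corrAct_le fun d hd => hd)
    (hj.le_of_forall_le fun d hd => le_corrAct (S := cone j φ) hd j)

lemma fits_cone_le [Finite T] (hj : IrrParam Q j) {X : FinCorr.{u}} {φ : X → T} {ψ : X ⟶ D}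
    {τ : Equiv.Perm D} (h : FinCorr.Fits Q (cone j φ ≫ ψ) τ) {d : D} {x : X}
    (hx : (τ d, x) ∈ ψ.rel) : φ x ≤ j d :=
  hj.le_of_forall_le fun b hb => (hj.mem_iff _ _).1 (h.2 d b ⟨x, hx, hb⟩)

/-- The right-hand relation is the larger one. An upper bound on all `φ x` also bounds their join,
so no fit is lost when joins are taken. Conversely, a fit forces the join to equal some `j d`, and
irreducibility makes one `φ x` attain it. -/
lemma fits_cone_corrAct [Finite T] (hj : IrrParam Q j) {X Y : FinCorr.{u}} (S : X ⟶ Y) (φ : X → T)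
    (ψ : Y ⟶ D) (τ : Equiv.Perm D) :
    FinCorr.Fits Q ((cone j φ ≫ S) ≫ ψ) τ ↔ FinCorr.Fits Q (cone j (corrAct S φ) ≫ ψ) τ := by
  have hle : ((cone j φ ≫ S) ≫ ψ).rel ⊆ (cone j (corrAct S φ) ≫ ψ).rel := by
    rintro ⟨a, d⟩ ⟨y, hy, x, hx, hd⟩
    exact ⟨y, hy, le_trans (show j d ≤ φ x from hd) (le_corrAct hx φ)⟩
  constructor
  · refine fun h => ⟨fun d => hle (h.1 d), ?_⟩
    rintro a b ⟨y, hy, hb⟩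
    refine (hj.mem_iff _ _).2 (le_trans (show j b ≤ corrAct S φ y from hb)
      (corrAct_le fun x hx => ?_))
    exact hj.le_of_forall_le fun d hd => (hj.mem_iff _ _).1 (h.2 a d ⟨y, hy, x, hx, hd⟩)
  · refine fun h => ⟨fun d => ?_, fun a b hab => h.2 a b (hle hab)⟩
    obtain ⟨y, hy, hd⟩ := h.1 d
    obtain ⟨x, hx, hxd⟩ := exists_of_corrAct_eq (hj.supIrred d)
      (le_antisymm (hj.fits_cone_le h hy) hd)
    exact ⟨y, hy, x, hx, hxd.ge⟩

/-- The two halves of a fit give `j d ≤ φ x` and `φ x ≤ j d` for a suitable `x`, so φ would take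
every irreducible value. -/
lemma not_fits_cone [Finite T] (hj : IrrParam Q j) {X : FinCorr.{u}} {φ : X → T}
    (hφ : ¬ {e : T | SupIrred e} ⊆ Set.range φ) (ψ : X ⟶ D) (τ : Equiv.Perm D) :
    ¬ FinCorr.Fits Q (cone j φ ≫ ψ) τ := by
  intro h
  apply hφ
  intro e he
  obtain ⟨d, rfl⟩ := (hj.supIrred_iff e).1 he
  obtain ⟨x, hx, hd⟩ := h.1 d
  exact ⟨x, le_antisymm (hj.fits_cone_le h hx) hd⟩

lemma toFundMap_latticeMap [Finite T] (hj : IrrParam Q j) {X Y : FinCorr.{u}}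
    (α : Free.of k X ⟶ Free.of k Y) :
    toFundMap k Q j Y ∘ₗ latticeMap k T X Y α =
      ((fundFunctor k Q).map α).hom ∘ₗ toFundMap k Q j X := by
  refine Finsupp.lhom_ext' fun φ => LinearMap.ext_ring ?_
  have H : toFundMap k Q j Y ∘ₗ (latticeMap k T X Y).flip (Finsupp.single φ 1) =
      (fundMk k Q (Free.of k Y)).flip (fundGen k Q) ∘ₗ
        Linear.leftComp k (Free.of k Y) (lin k (cone j φ)) := by
    refine lin_hom_ext fun S => ?_
    change toFundMap k Q j Y (latticeMap k T X Y (lin k S) (Finsupp.single φ 1)) =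
      fundMk k Q (Free.of k Y) (lin k (cone j φ) ≫ lin k S) (fundGen k Q)
    rw [latticeMap_lin, Finsupp.lmapDomain_apply, Finsupp.mapDomain_single, toFundMap_single,
      ← lin_comp]
    exact (fundMk_eq_of_fits (hj.fits_cone_corrAct S φ)).symm
  refine (LinearMap.congr_fun H α).trans ?_
  change fundMk k Q (Free.of k Y) (lin k (cone j φ) ≫ α) (fundGen k Q) =
    ((fundFunctor k Q).map α).hom (toFundMap k Q j X (Finsupp.single φ 1))
  rw [toFundMap_single, map_fundMk]

/-- The morphism `F_T ⟶ 𝕊_{D,Q}` sending `j` to the class of `Δ ⊗ f_Q`. -/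
def toFund [Finite T] (hj : IrrParam Q j) : latticeFunctor k T ⟶ fundFunctor k Q where
  app X := ModuleCat.ofHom (toFundMap k Q j X)
  naturality X Y α := ModuleCat.hom_ext (toFundMap_latticeMap k hj (X := X) (Y := Y) α)

lemma nonFullSubmodule_le_ker [Finite T] (hj : IrrParam Q j) (X : FinCorr.{u}) :
    nonFullSubmodule k T X ≤ LinearMap.ker (toFundMap k Q j X) := by
  refine Submodule.span_le.2 ?_
  rintro _ ⟨φ, hφ, rfl⟩
  rw [SetLike.mem_coe, LinearMap.mem_ker, toFundMap_single]
  exact fundMk_eq_zero_of_not_fits (hj.not_fits_cone hφ)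

/-- The morphism `F_T / H_T ⟶ 𝕊_{D,Q}` induced by `toFund`. -/
def toFundBar [Finite T] (hj : IrrParam Q j) :
    (nonFull k T).quotient ⟶ fundFunctor k Q where
  app X := ModuleCat.ofHom
    ((nonFullSubmodule k T X).liftQ (toFundMap k Q j X) (hj.nonFullSubmodule_le_ker k X))
  naturality X Y α := ModuleCat.hom_ext <| Submodule.linearMap_qext _
    (toFundMap_latticeMap k hj (X := X) (Y := Y) α)

lemma proj_toFundBar [Finite T] (hj : IrrParam Q j) :
    (nonFull k T).proj ≫ hj.toFundBar k = hj.toFund k := rfl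

lemma toFundBar_latMk [Finite T] (hj : IrrParam Q j) {X : FinCorr.{u}} (φ : X → T) :
    ((hj.toFundBar k).app (Free.of k X)).hom (latMk k φ) =
      fundMk k Q (Free.of k X) (lin k (cone j φ)) (fundGen k Q) :=
  toFundMap_single k φ

lemma toFund_self [Finite T] (hj : IrrParam Q j) :
    ((hj.toFund k).app (Free.of k D)).hom (Finsupp.single j 1) =
      fundUnit k Q (fundGen k Q) := by
  classical
  refine (toFundMap_single k j).trans ?_
  -- The cone of `j` over itself is `Q`, which moves across the tensor product and is absorbed by
  -- `f_Q`.
  rw [fundUnit_eq_fundMk, hj.cone_self, ← Category.comp_id (lin k (FinCorr.ofOrder Q)),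
    fundMk_comp]
  congr 1
  apply fundVal_injective k Q
  rw [fundVal_smul, fundVal_fundGen]
  exact (relClass_mul_fundIdempotent k (V := FinCorr.ofOrder Q) Q.refl Q).trans
    (if_pos (Set.Subset.refl Q.rel))

lemma map_cone_single [Finite T] (hj : IrrParam Q j) {X : FinCorr.{u}} (φ : X → T) :
    ((latticeFunctor k T).map (lin k (cone j φ))).hom (Finsupp.single j (1 : k)) =
      Finsupp.single φ (1 : k) := by
  change latticeMap k T D X (lin k (cone j φ)) (Finsupp.single j 1) = _
  rw [latticeMap_lin, Finsupp.lmapDomain_apply, Finsupp.mapDomain_single, hj.corrAct_cone]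

lemma map_cone_latMk [Finite T] (hj : IrrParam Q j) {X : FinCorr.{u}} (φ : X → T) :
    ((nonFull k T).quotient.map (lin k (cone j φ))).hom (latMk k j) = latMk k φ := by
  rw [map_latMk, hj.corrAct_cone]

/-- A morphism from `F_T` is determined by its value at `j`. -/
lemma latticeFunctor_hom_ext [Finite T] (hj : IrrParam Q j) {M : CorrFunctor.{u} k}
    {f g : latticeFunctor k T ⟶ M}
    (h : (f.app (Free.of k D)).hom (Finsupp.single j (1 : k)) =
      (g.app (Free.of k D)).hom (Finsupp.single j (1 : k))) : f = g := by
  ext X : 2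
  refine ModuleCat.hom_ext (Finsupp.lhom_ext' fun φ => LinearMap.ext_ring ?_)
  have hnat (f : latticeFunctor k T ⟶ M) :
      (f.app X).hom (Finsupp.single φ (1 : k)) =
        (M.map (lin k (cone (X := X) j φ))).hom
          ((f.app (Free.of k D)).hom (Finsupp.single j (1 : k))) := by
    rw [← hj.map_cone_single k (X := X) φ]
    exact LinearMap.congr_fun (congrArg ModuleCat.Hom.hom
      (f.naturality (lin k (cone (X := X) j φ)))) (Finsupp.single j (1 : k))
  exact (hnat f).trans ((congrArg _ h).trans (hnat g).symm)

lemma toFundBar_bijective [Finite T] (hj : IrrParam Q j) :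
    Function.Bijective ((hj.toFundBar k).app (Free.of k D)).hom := by
  constructor
  · let c : FundModule k Q →ₗ[k] (nonFull k T).quotient.obj (Free.of k D) :=
      (hj.orderAction k).toLinearMap.flip (latMk k j) ∘ₗ fundVal k Q
    have H : (c ∘ₗ fundCounit k Q) ∘ₗ ((hj.toFundBar k).app (Free.of k D)).hom =
        LinearMap.id := by
      refine latticeQuotient_hom_ext k fun φ => ?_
      rw [LinearMap.comp_apply, LinearMap.comp_apply, toFundBar_latMk]
      change hj.orderAction k (fundVal k Q (fundCounit k Q _)) (latMk k j) = latMk k φ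
      rw [fundCounit_fundMk, fundVal_smul, map_mul, Module.End.mul_apply, fundVal_fundGen,
        hj.orderAction_fundIdempotent k, orderAction_toPermutedOrders]
      exact hj.map_cone_latMk k φ
    exact Function.LeftInverse.injective (g := c ∘ₗ fundCounit k Q) fun x => LinearMap.congr_fun H x
  · intro x
    obtain ⟨w, rfl⟩ := (fundUnit_bijective k Q).2 x
    obtain ⟨a, rfl⟩ := exists_smul_fundGen k Q w
    refine ⟨((nonFull k T).quotient.map a).hom (latMk k j), ?_⟩
    rw [fundUnit_smul, ← hj.toFund_self k]
    exact LinearMap.congr_fun (congrArg ModuleCat.Hom.hom ((hj.toFundBar k).naturality a))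
      (latMk k j)

end IrrParam

/-! ### Surjective morphisms onto fundamental functors -/

section Surjective

variable (k : Type v) [CommRing k] {T : Type u} [Lattice T] [BoundedOrder T]
  {D E : FinCorr.{u}} {R : OrderOn E} {j : E → T}
  {Q : OrderOn D} {Φ : (nonFull k T).quotient ⟶ fundFunctor k Q}

lemma naturality_apply {X Y : LinCorr.{u} k} (α : X ⟶ Y) (x : (nonFull k T).quotient.obj X) :
    (Φ.app Y).hom (((nonFull k T).quotient.map α).hom x) =
      ((fundFunctor k Q).map α).hom ((Φ.app X).hom x) :=
  LinearMap.congr_fun (congrArg ModuleCat.Hom.hom (Φ.naturality α)) x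

variable [Nontrivial k]

lemma fundUnit_fundGen_ne_zero : fundUnit k Q (fundGen k Q) ≠ 0 := by
  intro h
  have h0 : fundGen k Q = 0 := (fundUnit_bijective k Q).1 (h.trans (map_zero _).symm)
  apply fundIdempotent_ne_zero k Q
  rw [← fundVal_fundGen, h0, map_zero]

namespace IrrParam

/-- `j` generates the source, so Φ would vanish with its value at `j`, although the fundamental
functor is nonzero at `D`. -/
lemma app_latMk_ne_zero [Finite T] (hj : IrrParam R j)
    (hΦ : Function.Surjective (Φ.app (Free.of k D)).hom) :
    (Φ.app (Free.of k E)).hom (latMk k j) ≠ 0 := by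
  intro h
  have H : (Φ.app (Free.of k D)).hom = 0 := by
    refine latticeQuotient_hom_ext k fun φ => ?_
    rw [← hj.map_cone_latMk k φ, naturality_apply, h, map_zero, LinearMap.zero_apply]
  obtain ⟨x, hx⟩ := hΦ (fundUnit k Q (fundGen k Q))
  rw [H] at hx
  exact fundUnit_fundGen_ne_zero k hx.symm

/-- The target vanishes below `|D|` but contains the nonzero image of `j` at `E`. The source
vanishes below `|E|` but surjects onto a nonzero module at `D`. -/
lemma card_eq [Finite T] (hj : IrrParam R j)
    (hΦ : Function.Surjective (Φ.app (Free.of k D)).hom) : Nat.card D = Nat.card E := by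
  apply le_antisymm
  · by_contra hlt
    exact hj.app_latMk_ne_zero k hΦ (fundFunctor_eq_zero k Q (not_le.1 hlt) _)
  · by_contra hlt
    obtain ⟨x, hx⟩ := hΦ (fundUnit k Q (fundGen k Q))
    rw [hj.latticeQuotient_eq_zero k (not_le.1 hlt) x, map_zero] at hx
    exact fundUnit_fundGen_ne_zero k hx.symm

lemma eq_conj [Finite T] {R : OrderOn D} {j : D → T} (hj : IrrParam R j)
    (hΦ : Function.Surjective (Φ.app (Free.of k D)).hom) :
    ∃ τ : Equiv.Perm D, R = Q.conj τ := by
  obtain ⟨w, hw⟩ := (fundUnit_bijective k Q).2 ((Φ.app (Free.of k D)).hom (latMk k j))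
  have hw0 : w ≠ 0 := by
    rintro rfl
    exact hj.app_latMk_ne_zero k hΦ (by rw [← hw, map_zero])
  -- The lift of `f_R` fixes `j`, hence by naturality its image, so `f_R` does not annihilate the
  -- fundamental module of `Q`.
  have hfix : fundLift k R • w = w := by
    apply (fundUnit_bijective k Q).1
    rw [fundUnit_smul, hw, ← naturality_apply]
    exact congrArg _ (hj.endAction_fundLift k)
  obtain ⟨a, rfl⟩ := exists_smul_fundGen k Q w
  have hne : fundIdempotent k R * (toPermutedOrders k D a * fundIdempotent k Q) ≠ 0 := by
    intro h
    apply hw0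
    apply fundVal_injective k Q
    rw [← hfix, fundVal_smul, fundVal_smul, toPermutedOrders_fundLift, fundVal_fundGen, h, map_zero]
  by_contra hτ
  push Not at hτ
  -- It suffices to treat a single relation `V`. A nonzero `V f_Q` is some Δ_τ `f_Q`, and `f_R`
  -- kills it unless τ carries `Q` to `R`.
  have H : LinearMap.mulLeft k (fundIdempotent k R) ∘ₗ
      LinearMap.mulRight k (fundIdempotent k Q) ∘ₗ (toPermutedOrders k D).toLinearMap = 0 := by
    refine lin_hom_ext fun V => ?_
    change fundIdempotent k R * (relClass k V * fundIdempotent k Q) = 0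
    by_contra hV
    obtain ⟨τ, hfit⟩ := exists_fits k (right_ne_zero_of_mul hV)
    rw [relClass_mul_fundIdempotent_of_fits k hfit] at hV
    exact hτ τ (eq_conj_of_mul_ne_zero k hV)
  exact hne (LinearMap.congr_fun H a)

end IrrParam

end Surjective

/-! ### Parametrizations of the irreducible elements -/

lemma irrParam_irr (T : Type u) [Lattice T] [Finite T] :
    IrrParam (irrOrder T).op (fun e : irr T => (Subtype.val e : T)) where
  injective := Subtype.val_injective
  supIrred_iff t := ⟨fun h => ⟨⟨t, h⟩, rfl⟩, fun ⟨d, hd⟩ => hd ▸ d.2⟩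
  mem_iff _ _ := Iff.rfl

/-- Transport of a parametrization along a bijection. -/
lemma IrrParam.comp_equiv {T : Type u} [Lattice T] {D E : FinCorr.{u}} {R : OrderOn E} {j : E → T}
    (hj : IrrParam R j) (e : D ≃ E) :
    ∃ R' : OrderOn D, IrrParam R' (j ∘ e) ∧ ∀ a b, (a, b) ∈ R'.rel ↔ (e a, e b) ∈ R.rel := by
  refine ⟨⟨{p | (e p.1, e p.2) ∈ R.rel}, fun _ => R.refl _,
    fun _ _ h h' => e.injective (R.antisymm _ _ h h'), fun _ _ _ h h' => R.trans _ _ _ h h'⟩,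
    ⟨hj.injective.comp e.injective, fun t => ?_, fun a b => hj.mem_iff (e a) (e b)⟩,
    fun _ _ => Iff.rfl⟩
  rw [hj.supIrred_iff]
  exact ⟨fun ⟨d, hd⟩ => ⟨e.symm d, by simpa using hd⟩, fun ⟨d, hd⟩ => ⟨e d, hd⟩⟩

end

theorem mainTheorem4 (k : Type v) [CommRing k] [Nontrivial k]
    (T : Type u) [Lattice T] [BoundedOrder T] [Finite T]
    (D : FinCorr.{u}) (Q : OrderOn D)
    (Φ : (nonFull k T).quotient ⟶ fundFunctor k Q)
    (hΦ : ∀ X, Function.Surjective (Φ.app X).hom) :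
    Nat.card D = Nat.card (irr T) ∧
    (∃ e : D ≃ irr T, ∀ a b : D, (a, b) ∈ Q.rel ↔ (e a, e b) ∈ (irrOrder T).op.rel) ∧
    ∃ Θ : latticeFunctor k T ⟶ fundFunctor k (irrOrder T).op,
      (Θ.app (Free.of k (irr T))).hom (irrIncl k T) =
          fundUnit k (irrOrder T).op (fundGen k (irrOrder T).op) ∧
      (∀ Θ' : latticeFunctor k T ⟶ fundFunctor k (irrOrder T).op,
        (Θ'.app (Free.of k (irr T))).hom (irrIncl k T) =
          fundUnit k (irrOrder T).op (fundGen k (irrOrder T).op) → Θ' = Θ) ∧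
      ∃ Θbar : (nonFull k T).quotient ⟶ fundFunctor k (irrOrder T).op,
        (nonFull k T).proj ≫ Θbar = Θ ∧
        (SubCorrFunctor.ker Θbar).obj (Free.of k (irr T)) = ⊥ ∧
        Function.Bijective (Θbar.app (Free.of k (irr T))).hom ∧
        Function.Bijective (fundUnit k (irrOrder T).op) ∧
        ∀ (a : End (Free.of k (irr T))) (w : FundModule k (irrOrder T).op),
          fundUnit k (irrOrder T).op (a • w) =
            ((fundFunctor k (irrOrder T).op).map a).hom (fundUnit k (irrOrder T).op w) := by
  have hj := irrParam_irr T
  have hcard := hj.card_eq k (hΦ (Free.of k D))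
  refine ⟨hcard, ?_, hj.toFund k, hj.toFund_self k, fun Θ' h =>
    hj.latticeFunctor_hom_ext k (h.trans (hj.toFund_self k).symm), hj.toFundBar k,
    hj.proj_toFundBar k, LinearMap.ker_eq_bot.2 (hj.toFundBar_bijective k).1,
    hj.toFundBar_bijective k, fundUnit_bijective k _, fundUnit_smul k _⟩
  obtain ⟨e⟩ := Finite.card_eq.1 hcard
  obtain ⟨R, hR, hRe⟩ := hj.comp_equiv e
  -- The bijection `e` is arbitrary, so the order pulled back along it is only a conjugate of `Q`;
  -- composing `e` with τ corrects this.
  obtain ⟨τ, rfl⟩ := hR.eq_conj k (hΦ (Free.of k D))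
  refine ⟨τ.trans e, fun a b => ?_⟩
  rw [Equiv.trans_apply, Equiv.trans_apply, ← hRe]
  simp [OrderOn.conj]
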